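/- Let $\mathrm{HA}^\omega$ be Heyting arithmetic in all finite types. Its types are built from $0$ (natural numbers) and the unit type $1$ by products $\rho\times\sigma$ and arrows $\rho\to\sigma$; its terms are those of the simply typed $\lambda$-calculus over these types ($\lambda$-abstraction, application, pairs $(t,s)$, projections $t_1,t_2$, the element $\mathbf 1$ of the unit type) with $0$, successor $S$ and primitive recursion into every type, taken up to $\beta\eta$-conversion and the recursor equations. Its prime formulas are the equations $t=_0s$ between terms of type $0$ and $\bot$; formulas are built by $\wedge,\vee,\to,\forall x^\rho,\exists x^\rho$, and $\neg A:=A\to\bot$. Derivability $\Gamma\vdash A$ is intuitionistic natural deduction with the axioms of equality for $=_0$ (convertible terms of type $0$ are equal; equals may be replaced by equals), $Sx=Sy\to x=y$, $Sx\neq0$, and induction for all formulas. Consider the schemata \[\mathrm{DNS}^\rho:\ \forall x^\rho\,\neg\neg A(x)\to\neg\neg\forall x^\rho A(x),\qquad \mathrm{AC}^{\rho,\sigma}:\ \forall x^\rho\exists y^\sigma A(x,y)\to\exists f^{\rho\to\sigma}\forall x^\rho A(x,f x).\] $\mathrm{AC}^\omega$ and $\mathrm{DNS}^\omega$ are these schemata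 for all $\rho,\sigma$; $\mathrm{AC}^0$ is $\mathrm{AC}^{0,\sigma}$ for all $\sigma$. A formula is arithmetical if all its quantifiers are of type $0$. Modified realizability with truth assigns to a formula $A$ and a term $t$, of a type determined by the logical form of $A$, the formula $t\ \mathsf{mrt}\ A$: \begin{align*} t\ \mathsf{mrt}\ P&:=P\quad(P\text{ prime},\ t\text{ of unit type}),\\ t\ \mathsf{mrt}\ (A\wedge B)&:=(t_1\ \mathsf{mrt}\ A)\wedge(t_2\ \mathsf{mrt}\ B),\\ t\ \mathsf{mrt}\ (A\vee B)&:=(t_2=_00\to t_{11}\ \mathsf{mrt}\ A)\wedge(t_2\neq_00\to t_{12}\ \mathsf{mrt}\ B),\\ t\ \mathsf{mrt}\ (A\to B)&:=\forall x\,(x\ \mathsf{mrt}\ A\to tx\ \mathsf{mrt}\ B)\wedge(A\to B),\\ t\ \mathsf{mrt}\ \exists y\,A(y)&:=t_1\ \mathsf{mrt}\ A(t_2),\\ t\ \mathsf{mrt}\ \forall y\,A(y)&:=\forall y\,(ty\ \mathsf{mrt}\ A(y)). \end{align*} Let $\vdash$ denote derivability in $\mathrm{HA}^\omega+\mathrm{AC}^\omega+\mathrm{DNS}^\omega$,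 or alternatively in $\mathrm{HA}^\omega+\mathrm{AC}^0+\mathrm{DNS}^0$. In either case: \begin{itemize} \item (EP) For all $\Gamma=A_1,\dots,A_k$ and every type $\tau$ and formula $A(x^\tau)$, all possibly open: if $\Gamma\vdash\exists x^\tau A(x)$, then there is a term $t$ of type $\tau$, whose free variables are among fresh variables $x_1,\dots,x_k$ and the free variables of $\Gamma$ and $\exists x^\tau A(x)$, such that $x_1\ \mathsf{mrt}\ A_1,\dots,x_k\ \mathsf{mrt}\ A_k\vdash A(t)$. \item (EP$^0$) For every closed arithmetical formula $\exists x^0A(x)$: if $\vdash\exists x^0A(x)$, then there is $n\in\mathbb N$ with $\vdash A(\overline n)$, where $\overline n=S^n0$. \item (DP$^0$) For every closed arithmetical formula $A\vee B$: if $\vdash A\vee B$, then $\vdash A$ or $\vdash B$. \item (WCR$^0$) For every closed arithmetical formula $\forall x^0\exists y^0A(x,y)$: if $\vdash\forall x^0\exists y^0A(x,y)$, then there is a total recursive function $f:\mathbb N\to\mathbb N$ such that $\vdash A(\overline n,\overline{f(n)})$ for all $n\in\mathbb N$. \end{itemize} -/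

import Mathlib

/-! Heyting arithmetic in all finite types, presented as intrinsically typed (de Bruijn) natural
deduction over a simply typed lambda calculus with arrow, product and unit types and primitive
recursion in all types; the schemata of choice and double-negation shift; and modified
realizability with truth. -/

namespace HAOmega

/-- The higher types. `nat` is the type `0`. -/
inductive Ty : Type
  | nat : Ty
  | unit : Ty
  | prod : Ty → Ty → Ty
  | arr : Ty → Ty → Ty

/-- A context lists the types of the individual variables that may occur free;
the head is the most recently bound variable. -/
abbrev Ctx := List Ty

/-- Individual variables of a given type in a context (typed de Bruijn indices). -/
inductive Var : Ctx → Ty → Type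
  | z {Δ : Ctx} {σ : Ty} : Var (σ :: Δ) σ
  | s {Δ : Ctx} {σ τ : Ty} : Var Δ σ → Var (τ :: Δ) σ

/-- Terms. `natRec a f n` is the recursor, with `f` taking the predecessor and then the
previous value. -/
inductive Tm : Ctx → Ty → Type
  | var {Δ : Ctx} {σ : Ty} : Var Δ σ → Tm Δ σ
  | lam {Δ : Ctx} {σ τ : Ty} : Tm (σ :: Δ) τ → Tm Δ (Ty.arr σ τ)
  | app {Δ : Ctx} {σ τ : Ty} : Tm Δ (Ty.arr σ τ) → Tm Δ σ → Tm Δ τ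
  | pair {Δ : Ctx} {σ τ : Ty} : Tm Δ σ → Tm Δ τ → Tm Δ (Ty.prod σ τ)
  | fst {Δ : Ctx} {σ τ : Ty} : Tm Δ (Ty.prod σ τ) → Tm Δ σ
  | snd {Δ : Ctx} {σ τ : Ty} : Tm Δ (Ty.prod σ τ) → Tm Δ τ
  | star {Δ : Ctx} : Tm Δ Ty.unit
  | zero {Δ : Ctx} : Tm Δ Ty.nat
  | succ {Δ : Ctx} : Tm Δ Ty.nat → Tm Δ Ty.nat
  | natRec {Δ : Ctx} {σ : Ty} :
      Tm Δ σ → Tm Δ (Ty.arr Ty.nat (Ty.arr σ σ)) → Tm Δ Ty.nat → Tm Δ σ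

/-- Renamings of variables. -/
abbrev Ren (Γ Δ : Ctx) := ∀ σ : Ty, Var Γ σ → Var Δ σ

/-- Extension of a renaming under a binder. -/
def Ren.lift {Γ Δ : Ctx} (r : Ren Γ Δ) (τ : Ty) : Ren (τ :: Γ) (τ :: Δ)
  | _, Var.z => Var.z
  | _, Var.s x => Var.s (r _ x)

/-- Renaming of terms. -/
def Tm.rename : {Γ Δ : Ctx} → {σ : Ty} → Ren Γ Δ → Tm Γ σ → Tm Δ σ
  | _, _, _, r, .var x => .var (r _ x)
  | _, _, _, r, .lam t => .lam (t.rename (r.lift _))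
  | _, _, _, r, .app t u => .app (t.rename r) (u.rename r)
  | _, _, _, r, .pair t u => .pair (t.rename r) (u.rename r)
  | _, _, _, r, .fst t => .fst (t.rename r)
  | _, _, _, r, .snd t => .snd (t.rename r)
  | _, _, _, _, .star => .star
  | _, _, _, _, .zero => .zero
  | _, _, _, r, .succ t => .succ (t.rename r)
  | _, _, _, r, .natRec a f n => .natRec (a.rename r) (f.rename r) (n.rename r)

/-- Weakening by one fresh variable. -/
def Tm.wk {Δ : Ctx} {σ τ : Ty} (t : Tm Δ σ) : Tm (τ :: Δ) σ :=
  t.rename fun _ x => Var.s x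

/-- Simultaneous substitutions. -/
abbrev Sub (Γ Δ : Ctx) := ∀ σ : Ty, Var Γ σ → Tm Δ σ

/-- The identity substitution. -/
def Sub.id (Δ : Ctx) : Sub Δ Δ := fun _ x => Tm.var x

/-- Extend a substitution by a term for the newest variable. -/
def Sub.cons {Γ Δ : Ctx} {τ : Ty} (t : Tm Δ τ) (s : Sub Γ Δ) : Sub (τ :: Γ) Δ
  | _, Var.z => t
  | _, Var.s x => s _ x

/-- Weaken the values of a substitution by one fresh variable. -/
def Sub.wk {Γ Δ : Ctx} (s : Sub Γ Δ) (τ : Ty) : Sub Γ (τ :: Δ) := fun _ x => (s _ x).wk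

/-- Extension of a substitution under a binder. -/
def Sub.lift {Γ Δ : Ctx} (s : Sub Γ Δ) (τ : Ty) : Sub (τ :: Γ) (τ :: Δ) :=
  Sub.cons (Tm.var Var.z) (s.wk τ)

/-- Substitution in terms. -/
def Tm.subst : {Γ Δ : Ctx} → {σ : Ty} → Sub Γ Δ → Tm Γ σ → Tm Δ σ
  | _, _, _, s, .var x => s _ x
  | _, _, _, s, .lam t => .lam (t.subst (s.lift _))
  | _, _, _, s, .app t u => .app (t.subst s) (u.subst s)
  | _, _, _, s, .pair t u => .pair (t.subst s) (u.subst s)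
  | _, _, _, s, .fst t => .fst (t.subst s)
  | _, _, _, s, .snd t => .snd (t.subst s)
  | _, _, _, _, .star => .star
  | _, _, _, _, .zero => .zero
  | _, _, _, s, .succ t => .succ (t.subst s)
  | _, _, _, s, .natRec a f n => .natRec (a.subst s) (f.subst s) (n.subst s)

/-- `t.inst u` is `t` with `u` in place of the newest variable. -/
def Tm.inst {Δ : Ctx} {σ τ : Ty} (t : Tm (τ :: Δ) σ) (u : Tm Δ τ) : Tm Δ σ :=
  t.subst (Sub.cons u (Sub.id Δ))

/-- The numeral of `n`. -/
def num {Δ : Ctx} : ℕ → Tm Δ Ty.nat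
  | 0 => .zero
  | n + 1 => .succ (num n)

/-- Conversion of terms: the least congruence containing the computation rules (beta,
projections, recursor) and the uniqueness rules of arrow, product and unit types. -/
inductive Conv : {Δ : Ctx} → {σ : Ty} → Tm Δ σ → Tm Δ σ → Prop
  | refl {Δ : Ctx} {σ : Ty} (t : Tm Δ σ) : Conv t t
  | symm {Δ : Ctx} {σ : Ty} {t u : Tm Δ σ} : Conv t u → Conv u t
  | trans {Δ : Ctx} {σ : Ty} {t u v : Tm Δ σ} : Conv t u → Conv u v → Conv t v
  | lam {Δ : Ctx} {σ τ : Ty} {t t' : Tm (σ :: Δ) τ} : Conv t t' → Conv (.lam t) (.lam t')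
  | app {Δ : Ctx} {σ τ : Ty} {t t' : Tm Δ (Ty.arr σ τ)} {u u' : Tm Δ σ} :
      Conv t t' → Conv u u' → Conv (.app t u) (.app t' u')
  | pair {Δ : Ctx} {σ τ : Ty} {t t' : Tm Δ σ} {u u' : Tm Δ τ} :
      Conv t t' → Conv u u' → Conv (.pair t u) (.pair t' u')
  | fst {Δ : Ctx} {σ τ : Ty} {t t' : Tm Δ (Ty.prod σ τ)} :
      Conv t t' → Conv (.fst t) (.fst t')
  | snd {Δ : Ctx} {σ τ : Ty} {t t' : Tm Δ (Ty.prod σ τ)} :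
      Conv t t' → Conv (.snd t) (.snd t')
  | succ {Δ : Ctx} {t t' : Tm Δ Ty.nat} : Conv t t' → Conv (.succ t) (.succ t')
  | natRec {Δ : Ctx} {σ : Ty} {a a' : Tm Δ σ} {f f' : Tm Δ (Ty.arr Ty.nat (Ty.arr σ σ))}
      {n n' : Tm Δ Ty.nat} :
      Conv a a' → Conv f f' → Conv n n' → Conv (.natRec a f n) (.natRec a' f' n')
  | beta {Δ : Ctx} {σ τ : Ty} (t : Tm (σ :: Δ) τ) (u : Tm Δ σ) :
      Conv (.app (.lam t) u) (t.inst u)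
  | eta {Δ : Ctx} {σ τ : Ty} (t : Tm Δ (Ty.arr σ τ)) :
      Conv (.lam (.app t.wk (.var .z))) t
  | fst_pair {Δ : Ctx} {σ τ : Ty} (t : Tm Δ σ) (u : Tm Δ τ) : Conv (.fst (.pair t u)) t
  | snd_pair {Δ : Ctx} {σ τ : Ty} (t : Tm Δ σ) (u : Tm Δ τ) : Conv (.snd (.pair t u)) u
  | pair_eta {Δ : Ctx} {σ τ : Ty} (t : Tm Δ (Ty.prod σ τ)) :
      Conv (.pair (.fst t) (.snd t)) t
  | unit_eta {Δ : Ctx} (t : Tm Δ Ty.unit) : Conv t .star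
  | natRec_zero {Δ : Ctx} {σ : Ty} (a : Tm Δ σ) (f : Tm Δ (Ty.arr Ty.nat (Ty.arr σ σ))) :
      Conv (.natRec a f .zero) a
  | natRec_succ {Δ : Ctx} {σ : Ty} (a : Tm Δ σ) (f : Tm Δ (Ty.arr Ty.nat (Ty.arr σ σ)))
      (n : Tm Δ Ty.nat) :
      Conv (.natRec a f (.succ n)) (.app (.app f n) (.natRec a f n))

/-- Formulas with free variables in a context. The prime formulas are the equations between
terms of type `0` and falsity. -/
inductive Fm : Ctx → Type
  | eq {Δ : Ctx} : Tm Δ Ty.nat → Tm Δ Ty.nat → Fm Δ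
  | bot {Δ : Ctx} : Fm Δ
  | and {Δ : Ctx} : Fm Δ → Fm Δ → Fm Δ
  | or {Δ : Ctx} : Fm Δ → Fm Δ → Fm Δ
  | imp {Δ : Ctx} : Fm Δ → Fm Δ → Fm Δ
  | all {Δ : Ctx} (σ : Ty) : Fm (σ :: Δ) → Fm Δ
  | ex {Δ : Ctx} (σ : Ty) : Fm (σ :: Δ) → Fm Δ

/-- Negation. -/
def Fm.neg {Δ : Ctx} (A : Fm Δ) : Fm Δ := .imp A .bot

/-- Capture-avoiding simultaneous substitution in formulas. -/
def Fm.subst : {Γ Δ : Ctx} → Sub Γ Δ → Fm Γ → Fm Δ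
  | _, _, s, .eq t u => .eq (t.subst s) (u.subst s)
  | _, _, _, .bot => .bot
  | _, _, s, .and A B => .and (A.subst s) (B.subst s)
  | _, _, s, .or A B => .or (A.subst s) (B.subst s)
  | _, _, s, .imp A B => .imp (A.subst s) (B.subst s)
  | _, _, s, .all σ A => .all σ (A.subst (s.lift σ))
  | _, _, s, .ex σ A => .ex σ (A.subst (s.lift σ))

/-- Weakening by one fresh variable. -/
def Fm.wk {Δ : Ctx} (τ : Ty) (A : Fm Δ) : Fm (τ :: Δ) := A.subst ((Sub.id Δ).wk τ)

/-- `A.inst t` is `A(t)`, where `A(x)` has the newest variable `x`. -/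
def Fm.inst {Δ : Ctx} {τ : Ty} (A : Fm (τ :: Δ)) (t : Tm Δ τ) : Fm Δ :=
  A.subst (Sub.cons t (Sub.id Δ))

/-- A formula is arithmetical if all its quantifiers have type `0`. -/
def Fm.Arithmetical : {Δ : Ctx} → Fm Δ → Prop
  | _, .eq _ _ => True
  | _, .bot => True
  | _, .and A B => A.Arithmetical ∧ B.Arithmetical
  | _, .or A B => A.Arithmetical ∧ B.Arithmetical
  | _, .imp A B => A.Arithmetical ∧ B.Arithmetical
  | _, .all σ A => σ = Ty.nat ∧ A.Arithmetical
  | _, .ex σ A => σ = Ty.nat ∧ A.Arithmetical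

/-- For `A(x)` with newest variable `x` of type `0`, the formula `A(S x)`. -/
def Fm.atSucc {Δ : Ctx} (A : Fm (Ty.nat :: Δ)) : Fm (Ty.nat :: Δ) :=
  A.subst (Sub.cons (.succ (.var .z)) ((Sub.id Δ).wk Ty.nat))

/-- The instance `∀ x^ρ ¬¬A(x) → ¬¬∀ x^ρ A(x)` of the double-negation shift. -/
def dns {Δ : Ctx} (ρ : Ty) (A : Fm (ρ :: Δ)) : Fm Δ :=
  .imp (.all ρ A.neg.neg) (Fm.all ρ A).neg.neg

/-- For `A(x,y)` with newest variable `y` and next newest `x`, the formula `A(x, f x)`,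
in which `x` is the newest variable and `f` the next newest. -/
def Fm.atApp {Δ : Ctx} {ρ σ : Ty} (A : Fm (σ :: ρ :: Δ)) : Fm (ρ :: Ty.arr ρ σ :: Δ) :=
  A.subst (Sub.cons (.app (.var (.s .z)) (.var .z))
    (Sub.cons (.var .z) (((Sub.id Δ).wk (Ty.arr ρ σ)).wk ρ)))

/-- The instance `∀ x^ρ ∃ y^σ A(x,y) → ∃ f^(ρ→σ) ∀ x^ρ A(x, f x)` of the axiom of choice. -/
def ac {Δ : Ctx} (ρ σ : Ty) (A : Fm (σ :: ρ :: Δ)) : Fm Δ :=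
  .imp (.all ρ (.ex σ A)) (.ex (Ty.arr ρ σ) (.all ρ A.atApp))

/-- `Prf R Γ A`: in Heyting arithmetic in all finite types, together with choice from type `ρ`
to every type `σ` and double-negation shift at type `ρ` for every `ρ ∈ R`, the formula `A` is
derivable from the assumptions `Γ`. -/
inductive Prf (R : Set Ty) : {Δ : Ctx} → List (Fm Δ) → Fm Δ → Prop
  | ax {Δ : Ctx} {Γ : List (Fm Δ)} {A : Fm Δ} : A ∈ Γ → Prf R Γ A
  | andI {Δ : Ctx} {Γ : List (Fm Δ)} {A B : Fm Δ} :
      Prf R Γ A → Prf R Γ B → Prf R Γ (.and A B)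
  | andE₁ {Δ : Ctx} {Γ : List (Fm Δ)} {A B : Fm Δ} : Prf R Γ (.and A B) → Prf R Γ A
  | andE₂ {Δ : Ctx} {Γ : List (Fm Δ)} {A B : Fm Δ} : Prf R Γ (.and A B) → Prf R Γ B
  | orI₁ {Δ : Ctx} {Γ : List (Fm Δ)} {A B : Fm Δ} : Prf R Γ A → Prf R Γ (.or A B)
  | orI₂ {Δ : Ctx} {Γ : List (Fm Δ)} {A B : Fm Δ} : Prf R Γ B → Prf R Γ (.or A B)
  | orE {Δ : Ctx} {Γ : List (Fm Δ)} {A B C : Fm Δ} :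
      Prf R Γ (.or A B) → Prf R (A :: Γ) C → Prf R (B :: Γ) C → Prf R Γ C
  | impI {Δ : Ctx} {Γ : List (Fm Δ)} {A B : Fm Δ} : Prf R (A :: Γ) B → Prf R Γ (.imp A B)
  | impE {Δ : Ctx} {Γ : List (Fm Δ)} {A B : Fm Δ} :
      Prf R Γ (.imp A B) → Prf R Γ A → Prf R Γ B
  | botE {Δ : Ctx} {Γ : List (Fm Δ)} {A : Fm Δ} : Prf R Γ .bot → Prf R Γ A
  | allI {Δ : Ctx} {Γ : List (Fm Δ)} {σ : Ty} {A : Fm (σ :: Δ)} :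
      Prf R (Γ.map (Fm.wk σ)) A → Prf R Γ (.all σ A)
  | allE {Δ : Ctx} {Γ : List (Fm Δ)} {σ : Ty} {A : Fm (σ :: Δ)} (t : Tm Δ σ) :
      Prf R Γ (.all σ A) → Prf R Γ (A.inst t)
  | exI {Δ : Ctx} {Γ : List (Fm Δ)} {σ : Ty} {A : Fm (σ :: Δ)} (t : Tm Δ σ) :
      Prf R Γ (A.inst t) → Prf R Γ (.ex σ A)
  | exE {Δ : Ctx} {Γ : List (Fm Δ)} {σ : Ty} {A : Fm (σ :: Δ)} {C : Fm Δ} :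
      Prf R Γ (.ex σ A) → Prf R (A :: Γ.map (Fm.wk σ)) (C.wk σ) → Prf R Γ C
  | eqConv {Δ : Ctx} {Γ : List (Fm Δ)} {t u : Tm Δ Ty.nat} : Conv t u → Prf R Γ (.eq t u)
  | eqSubst {Δ : Ctx} {Γ : List (Fm Δ)} {t u : Tm Δ Ty.nat} (A : Fm (Ty.nat :: Δ)) :
      Prf R Γ (.eq t u) → Prf R Γ (A.inst t) → Prf R Γ (A.inst u)
  | succ_inj {Δ : Ctx} {Γ : List (Fm Δ)} {t u : Tm Δ Ty.nat} :
      Prf R Γ (.eq (.succ t) (.succ u)) → Prf R Γ (.eq t u)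
  | succ_ne_zero {Δ : Ctx} {Γ : List (Fm Δ)} {t : Tm Δ Ty.nat} :
      Prf R Γ (Fm.eq (.succ t) .zero).neg
  | ind {Δ : Ctx} {Γ : List (Fm Δ)} (A : Fm (Ty.nat :: Δ)) :
      Prf R Γ (A.inst .zero) → Prf R Γ (.all Ty.nat (.imp A A.atSucc)) →
        Prf R Γ (.all Ty.nat A)
  | ac {Δ : Ctx} {Γ : List (Fm Δ)} {ρ : Ty} (σ : Ty) (A : Fm (σ :: ρ :: Δ)) :
      ρ ∈ R → Prf R Γ (ac ρ σ A)
  | dns {Δ : Ctx} {Γ : List (Fm Δ)} {ρ : Ty} (A : Fm (ρ :: Δ)) :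
      ρ ∈ R → Prf R Γ (dns ρ A)

/-- The type of the realizers of a formula. -/
def Fm.rtype : {Δ : Ctx} → Fm Δ → Ty
  | _, .eq _ _ => .unit
  | _, .bot => .unit
  | _, .and A B => .prod A.rtype B.rtype
  | _, .or A B => .prod (.prod A.rtype B.rtype) .nat
  | _, .imp A B => .arr A.rtype B.rtype
  | _, .all σ A => .arr σ A.rtype
  | _, .ex σ A => .prod A.rtype σ

/-- Modified realizability with truth: `mrt A s t` is the formula "`t` realizes `A[s]`", where
`s` is a substitution for the free variables of `A`. (Carrying `s` along lets `A(t₂)` occur in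
the clause for the existential quantifier without changing the formula recursed on.) -/
def mrt : {Γ Δ : Ctx} → (A : Fm Γ) → Sub Γ Δ → Tm Δ A.rtype → Fm Δ
  | _, _, .eq a b, s, _ => .eq (a.subst s) (b.subst s)
  | _, _, .bot, _, _ => .bot
  | _, _, .and A B, s, t => .and (mrt A s (.fst t)) (mrt B s (.snd t))
  | _, _, .or A B, s, t =>
      .and (.imp (.eq (.snd t) .zero) (mrt A s (.fst (.fst t))))
        (.imp (Fm.eq (.snd t) .zero).neg (mrt B s (.snd (.fst t))))
  | _, _, .imp A B, s, t =>
      .and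
        (.all A.rtype (.imp (mrt A (s.wk A.rtype) (.var .z))
          (mrt B (s.wk A.rtype) (.app (Tm.wk t) (.var .z)))))
        (.imp (A.subst s) (B.subst s))
  | _, _, .all σ A, s, t => .all σ (mrt A (s.lift σ) (.app (Tm.wk t) (.var .z)))
  | _, _, .ex _ A, s, t => mrt A (Sub.cons (.snd t) s) (.fst t)

/-- The context `Δ` extended by one fresh variable `x_i` for each assumption `A_i` in the list,
of the type of the realizers of `A_i`. -/
def realCtx {Δ : Ctx} : List (Fm Δ) → Ctx
  | [] => Δ
  | A :: Γ => A.rtype :: realCtx Γ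

/-- The inclusion of `Δ` in the extended context. -/
def realWk {Δ : Ctx} : (Γ : List (Fm Δ)) → Sub Δ (realCtx Γ)
  | [] => Sub.id Δ
  | A :: Γ => (realWk Γ).wk A.rtype

/-- The assumptions "`x_i` realizes `A_i`" for the fresh variables `x_i`. -/
def mrtCtx {Δ : Ctx} : (Γ : List (Fm Δ)) → List (Fm (realCtx Γ))
  | [] => []
  | A :: Γ => mrt A (realWk (A :: Γ)) (.var .z) :: (mrtCtx Γ).map (Fm.wk A.rtype)

end HAOmega

open HAOmega

namespace HAOmega

/-! ### The substitution calculus -/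

/-! The theorem rests on soundness of the interpretation (`Prf.realizable`): whenever `A` is
derivable from assumptions that have realizers, some term provably realizes `A`. Because the clause
for implication also contains the implication itself, a realized formula is derivable
(`Prf.truth_of_mrt`). A realizer of an existential formula contains a witness together with a
realizer of the instance, so the existence property follows by reading off the witness and passing
to truth.

Truth is also what makes double-negation shift harmless. Any realizer of `A` yields `A`, so a true
negation is realized trivially (`Realizable.neg_intro`). The conclusion of DNS is a negation, hence
DNS at a type is realized with the help of DNS at the same type. Choice is realized by splitting a
realizer of its premise into a choice function and realizers of the values; its truth part is choice
at the same types. The argument is therefore uniform in the set `R` of types.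

The numerical properties need, in addition, that closed terms of type `0` convert to numerals.
Instead of normalization, a logical relation (`Computes`) links terms to indices of partial
recursive functions. Its fundamental lemma (`Tm.exists_partrec`) yields numerals for closed terms
and, for a witness with one numerical variable, the recursive function of the weak Church rule. -/

theorem Ren.lift_comp {Γ Δ Ξ : Ctx} (r : Ren Γ Δ) (r' : Ren Δ Ξ) (τ : Ty) :
    (fun σ x => r'.lift τ σ (r.lift τ σ x)) = Ren.lift (fun σ x => r' σ (r σ x)) τ := by
  funext σ x; cases x <;> rfl

theorem Tm.rename_rename {Γ : Ctx} {σ : Ty} (t : Tm Γ σ) : ∀ {Δ Ξ : Ctx} (r : Ren Γ Δ)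
    (r' : Ren Δ Ξ), (t.rename r).rename r' = t.rename (fun σ x => r' σ (r σ x)) := by
  induction t <;> intros <;> simp_all [Tm.rename, Ren.lift_comp]

theorem Sub.lift_ren {Γ Δ Ξ : Ctx} (r : Ren Γ Δ) (s : Sub Δ Ξ) (τ : Ty) :
    (fun σ x => s.lift τ σ (r.lift τ σ x)) = Sub.lift (fun σ x => s σ (r σ x)) τ := by
  funext σ x; cases x <;> rfl

theorem Tm.subst_rename {Γ : Ctx} {σ : Ty} (t : Tm Γ σ) : ∀ {Δ Ξ : Ctx} (r : Ren Γ Δ)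
    (s : Sub Δ Ξ), (t.rename r).subst s = t.subst (fun σ x => s σ (r σ x)) := by
  induction t <;> intros <;> simp_all [Tm.rename, Tm.subst, Sub.lift_ren]

theorem Sub.ren_lift {Γ Δ Ξ : Ctx} (s : Sub Γ Δ) (r : Ren Δ Ξ) (τ : Ty) :
    (fun σ x => (s.lift τ σ x).rename (r.lift τ)) =
      Sub.lift (fun σ x => (s σ x).rename r) τ := by
  funext σ x
  cases x with
  | z => rfl
  | s x => simp only [Sub.lift, Sub.cons, Sub.wk, Tm.wk, Tm.rename_rename]; rfl

theorem Tm.rename_subst {Γ : Ctx} {σ : Ty} (t : Tm Γ σ) : ∀ {Δ Ξ : Ctx} (s : Sub Γ Δ)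
    (r : Ren Δ Ξ), (t.subst s).rename r = t.subst (fun σ x => (s σ x).rename r) := by
  induction t <;> intros <;> simp_all [Tm.rename, Tm.subst, Sub.ren_lift]

/-- Composition of substitutions, in diagrammatic order. -/
def Sub.comp {Γ Δ Ξ : Ctx} (s : Sub Γ Δ) (θ : Sub Δ Ξ) : Sub Γ Ξ :=
  fun _ x => (s _ x).subst θ

/-- Lifting weakens values by a renaming, so composition passes a binder only by the two mixed laws
for renaming and substitution. -/
theorem Sub.lift_comp {Γ Δ Ξ : Ctx} (s : Sub Γ Δ) (θ : Sub Δ Ξ) (τ : Ty) :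
    (s.comp θ).lift τ = (s.lift τ).comp (θ.lift τ) := by
  funext σ x
  cases x with
  | z => rfl
  | s x =>
    simp only [Sub.comp, Sub.lift, Sub.cons, Sub.wk, Tm.wk, Tm.rename_subst, Tm.subst_rename]

theorem Tm.subst_subst {Γ : Ctx} {σ : Ty} (t : Tm Γ σ) : ∀ {Δ Ξ : Ctx} (s : Sub Γ Δ)
    (θ : Sub Δ Ξ), (t.subst s).subst θ = t.subst (s.comp θ) := by
  induction t <;> intros <;> simp_all [Tm.subst, Sub.lift_comp]
  rfl

@[simp] theorem Sub.lift_id (Δ : Ctx) (τ : Ty) : (Sub.id Δ).lift τ = Sub.id (τ :: Δ) := by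
  funext σ x; cases x <;> rfl

@[simp] theorem Tm.subst_id {Γ : Ctx} {σ : Ty} (t : Tm Γ σ) : t.subst (Sub.id Γ) = t := by
  induction t <;> simp_all [Tm.subst]
  rfl

theorem Tm.rename_eq_subst {Γ Δ : Ctx} {σ : Ty} (t : Tm Γ σ) (r : Ren Γ Δ) :
    t.rename r = t.subst (fun σ x => .var (r σ x)) := by
  rw [← Tm.subst_id (t.rename r), Tm.subst_rename]; rfl

theorem Tm.wk_eq_subst {Δ : Ctx} {σ : Ty} (t : Tm Δ σ) (τ : Ty) :
    (t.wk : Tm (τ :: Δ) σ) = t.subst ((Sub.id Δ).wk τ) :=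
  t.rename_eq_subst _

@[simp] theorem Tm.wk_subst_cons {Γ Δ : Ctx} {σ τ : Ty} (t : Tm Γ σ) (u : Tm Δ τ)
    (s : Sub Γ Δ) : t.wk.subst (Sub.cons u s) = t.subst s :=
  t.subst_rename _ _

theorem Tm.subst_wk {Γ Δ : Ctx} {σ : Ty} (t : Tm Γ σ) (s : Sub Γ Δ) (τ : Ty) :
    t.subst (s.wk τ) = (t.subst s).wk :=
  (t.rename_subst _ _).symm

@[simp] theorem Tm.wk_subst_lift {Γ Δ : Ctx} {σ : Ty} (t : Tm Γ σ) (s : Sub Γ Δ) (τ : Ty) :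
    t.wk.subst (s.lift τ) = (t.subst s).wk := by
  rw [Sub.lift, Tm.wk_subst_cons, Tm.subst_wk]

@[simp] theorem Sub.cons_comp {Γ Δ Ξ : Ctx} {τ : Ty} (t : Tm Δ τ) (s : Sub Γ Δ)
    (θ : Sub Δ Ξ) : (Sub.cons t s).comp θ = Sub.cons (t.subst θ) (s.comp θ) := by
  funext σ x; cases x <;> rfl

@[simp] theorem Sub.id_comp {Γ Δ : Ctx} (s : Sub Γ Δ) : (Sub.id Γ).comp s = s := rfl

@[simp] theorem Sub.comp_id {Γ Δ : Ctx} (s : Sub Γ Δ) : s.comp (Sub.id Δ) = s := by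
  funext σ x; exact Tm.subst_id _

@[simp] theorem Sub.wk_comp_cons {Γ Δ Ξ : Ctx} {τ : Ty} (s : Sub Γ Δ) (t : Tm Ξ τ)
    (θ : Sub Δ Ξ) : (s.wk τ).comp (Sub.cons t θ) = s.comp θ := by
  funext σ x; exact Tm.wk_subst_cons _ _ _

theorem Sub.comp_wk {Γ Δ Ξ : Ctx} (s : Sub Γ Δ) (θ : Sub Δ Ξ) (τ : Ty) :
    s.comp (θ.wk τ) = (s.comp θ).wk τ := by
  funext σ x; exact Tm.subst_wk _ _ _

@[simp] theorem Sub.wk_comp_lift {Γ Δ Ξ : Ctx} {τ : Ty} (s : Sub Γ Δ) (θ : Sub Δ Ξ) :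
    (s.wk τ).comp (θ.lift τ) = (s.comp θ).wk τ := by
  rw [Sub.lift, Sub.wk_comp_cons, Sub.comp_wk]

@[simp] theorem Sub.lift_comp_cons {Γ Δ Ξ : Ctx} {τ : Ty} (s : Sub Γ Δ) (t : Tm Ξ τ)
    (θ : Sub Δ Ξ) : (s.lift τ).comp (Sub.cons t θ) = Sub.cons t (s.comp θ) := by
  simp [Sub.lift, Tm.subst, Sub.cons]

@[simp] theorem Tm.wk_inst {Δ : Ctx} {σ τ : Ty} (t : Tm Δ σ) (u : Tm Δ τ) :
    t.wk.inst u = t := by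
  simp [Tm.inst]

@[simp] theorem num_subst {Γ Δ : Ctx} (s : Sub Γ Δ) (n : ℕ) : (num n).subst s = num n := by
  induction n <;> simp_all [num, Tm.subst]

theorem Fm.subst_subst {Γ : Ctx} (A : Fm Γ) : ∀ {Δ Ξ : Ctx} (s : Sub Γ Δ) (θ : Sub Δ Ξ),
    (A.subst s).subst θ = A.subst (s.comp θ) := by
  induction A <;> intros <;> simp_all [Fm.subst, Tm.subst_subst, Sub.lift_comp]

@[simp] theorem Fm.subst_id {Γ : Ctx} (A : Fm Γ) : A.subst (Sub.id Γ) = A := by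
  induction A <;> simp_all [Fm.subst]

@[simp] theorem Fm.wk_subst_cons {Γ Δ : Ctx} {τ : Ty} (A : Fm Γ) (u : Tm Δ τ)
    (s : Sub Γ Δ) : (A.wk τ).subst (Sub.cons u s) = A.subst s := by
  simp [Fm.wk, Fm.subst_subst]

theorem Fm.subst_wk {Γ Δ : Ctx} (A : Fm Γ) (s : Sub Γ Δ) (τ : Ty) :
    A.subst (s.wk τ) = (A.subst s).wk τ := by
  simp [Fm.wk, Fm.subst_subst, Sub.comp_wk]

@[simp] theorem Fm.wk_subst_lift {Γ Δ : Ctx} {τ : Ty} (A : Fm Γ) (s : Sub Γ Δ) :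
    (A.wk τ).subst (s.lift τ) = (A.subst s).wk τ := by
  rw [Sub.lift, Fm.wk_subst_cons, Fm.subst_wk]

@[simp] theorem Fm.wk_inst {Δ : Ctx} {τ : Ty} (A : Fm Δ) (u : Tm Δ τ) :
    (A.wk τ).inst u = A := by
  simp [Fm.inst]

theorem Fm.subst_lift_inst {Γ Δ : Ctx} {τ : Ty} (A : Fm (τ :: Γ)) (s : Sub Γ Δ)
    (u : Tm Δ τ) : (A.subst (s.lift τ)).inst u = A.subst (Sub.cons u s) := by
  simp [Fm.inst, Fm.subst_subst]

theorem Fm.inst_subst {Γ Δ : Ctx} {τ : Ty} (A : Fm (τ :: Γ)) (u : Tm Γ τ) (s : Sub Γ Δ) :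
    (A.inst u).subst s = (A.subst (s.lift τ)).inst (u.subst s) := by
  simp [Fm.inst, Fm.subst_subst]

theorem Fm.atSucc_subst {Γ Δ : Ctx} (A : Fm (Ty.nat :: Γ)) (s : Sub Γ Δ) :
    A.atSucc.subst (s.lift Ty.nat) = (A.subst (s.lift Ty.nat)).atSucc := by
  simp only [Fm.atSucc, Fm.subst_subst, Sub.cons_comp, Sub.wk_comp_lift, Sub.lift_comp_cons,
    Sub.id_comp, Sub.comp_wk, Sub.comp_id, Tm.subst]
  rfl

theorem Fm.atApp_subst {Γ Δ : Ctx} {ρ σ : Ty} (A : Fm (σ :: ρ :: Γ)) (s : Sub Γ Δ) :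
    A.atApp.subst ((s.lift (Ty.arr ρ σ)).lift ρ) = ((A.subst ((s.lift ρ).lift σ))).atApp := by
  simp only [Fm.atApp, Fm.subst_subst, Sub.cons_comp, Sub.wk_comp_lift, Sub.lift_comp_cons,
    Sub.id_comp, Sub.comp_wk, Sub.comp_id, Tm.subst]
  rfl

theorem ac_subst {Γ Δ : Ctx} {ρ σ : Ty} (A : Fm (σ :: ρ :: Γ)) (s : Sub Γ Δ) :
    (ac ρ σ A).subst s = ac ρ σ (A.subst ((s.lift ρ).lift σ)) := by
  simp [ac, Fm.subst, Fm.atApp_subst]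

theorem dns_subst {Γ Δ : Ctx} {ρ : Ty} (A : Fm (ρ :: Γ)) (s : Sub Γ Δ) :
    (dns ρ A).subst s = dns ρ (A.subst (s.lift ρ)) := rfl

theorem map_wk_subst {Γ Δ : Ctx} (L : List (Fm Γ)) (s : Sub Γ Δ) (τ : Ty) :
    (L.map (Fm.wk τ)).map (Fm.subst (s.lift τ)) = (L.map (Fm.subst s)).map (Fm.wk τ) := by
  simp

/-! ### Conversion and substitution -/

theorem Conv.of_eq {Δ : Ctx} {σ : Ty} {t u : Tm Δ σ} (h : t = u) : Conv t u :=
  h ▸ Conv.refl t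

theorem Conv.subst {Γ : Ctx} {σ : Ty} {t u : Tm Γ σ} (h : Conv t u) :
    ∀ {Δ : Ctx} (s : Sub Γ Δ), Conv (t.subst s) (u.subst s) := by
  induction h with
  | refl t => intros; exact .refl _
  | symm _ ih => intro _ s; exact (ih s).symm
  | trans _ _ ih₁ ih₂ => intro _ s; exact (ih₁ s).trans (ih₂ s)
  | lam _ ih => intro _ s; exact .lam (ih _)
  | app _ _ ih₁ ih₂ => intro _ s; exact .app (ih₁ s) (ih₂ s)
  | pair _ _ ih₁ ih₂ => intro _ s; exact .pair (ih₁ s) (ih₂ s)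
  | fst _ ih => intro _ s; exact .fst (ih s)
  | snd _ ih => intro _ s; exact .snd (ih s)
  | succ _ ih => intro _ s; exact .succ (ih s)
  | natRec _ _ _ ih₁ ih₂ ih₃ => intro _ s; exact .natRec (ih₁ s) (ih₂ s) (ih₃ s)
  | beta t u =>
    intro _ s
    refine (Conv.beta _ _).trans (.of_eq ?_)
    simp [Tm.inst, Tm.subst_subst]
  | eta t =>
    intro _ s
    refine Conv.trans (.of_eq ?_) (Conv.eta _)
    simp [Tm.subst]
    rfl
  | fst_pair t u => intros; exact .fst_pair _ _
  | snd_pair t u => intros; exact .snd_pair _ _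
  | pair_eta t => intros; exact .pair_eta _
  | unit_eta t => intros; exact .unit_eta _
  | natRec_zero a f => intros; exact .natRec_zero _ _
  | natRec_succ a f n => intros; exact .natRec_succ _ _ _

theorem Conv.wk {Δ : Ctx} {σ : Ty} {t u : Tm Δ σ} (h : Conv t u) (τ : Ty) :
    Conv (t.wk : Tm (τ :: Δ) σ) u.wk := by
  rw [Tm.wk_eq_subst, Tm.wk_eq_subst]; exact h.subst _

/-- Pointwise convertibility of substitutions. -/
def Sub.Conv {Γ Δ : Ctx} (s s' : Sub Γ Δ) : Prop := ∀ σ x, HAOmega.Conv (s σ x) (s' σ x)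

theorem Sub.Conv.refl {Γ Δ : Ctx} (s : Sub Γ Δ) : s.Conv s := fun _ _ => .refl _

theorem Sub.Conv.wk {Γ Δ : Ctx} {s s' : Sub Γ Δ} (h : s.Conv s') (τ : Ty) :
    (s.wk τ).Conv (s'.wk τ) := fun _ x => (h _ x).wk τ

theorem Sub.Conv.cons {Γ Δ : Ctx} {s s' : Sub Γ Δ} (h : s.Conv s') {τ : Ty} {t t' : Tm Δ τ}
    (ht : HAOmega.Conv t t') : (Sub.cons t s).Conv (Sub.cons t' s')
  | _, .z => ht
  | _, .s x => h _ x

theorem Sub.Conv.lift {Γ Δ : Ctx} {s s' : Sub Γ Δ} (h : s.Conv s') (τ : Ty) :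
    (s.lift τ).Conv (s'.lift τ) := (h.wk τ).cons (.refl _)

theorem Tm.subst_conv {Γ : Ctx} {σ : Ty} (t : Tm Γ σ) :
    ∀ {Δ : Ctx} {s s' : Sub Γ Δ}, s.Conv s' → Conv (t.subst s) (t.subst s') := by
  induction t with
  | var x => intro _ _ _ h; exact h _ x
  | lam _ ih => intro _ _ _ h; exact .lam (ih (h.lift _))
  | app _ _ ih₁ ih₂ => intro _ _ _ h; exact .app (ih₁ h) (ih₂ h)
  | pair _ _ ih₁ ih₂ => intro _ _ _ h; exact .pair (ih₁ h) (ih₂ h)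
  | fst _ ih => intro _ _ _ h; exact .fst (ih h)
  | snd _ ih => intro _ _ _ h; exact .snd (ih h)
  | star => intros; exact .refl _
  | zero => intros; exact .refl _
  | succ _ ih => intro _ _ _ h; exact .succ (ih h)
  | natRec _ _ _ ih₁ ih₂ ih₃ => intro _ _ _ h; exact .natRec (ih₁ h) (ih₂ h) (ih₃ h)

variable {R : Set Ty}

/-! ### Structural properties of derivability -/

theorem Prf.subst {Γ : Ctx} {L : List (Fm Γ)} {A : Fm Γ} (h : Prf R L A) :
    ∀ {Δ : Ctx} (s : Sub Γ Δ), Prf R (L.map (Fm.subst s)) (A.subst s) := by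
  induction h with
  | ax h => intro _ s; exact .ax (List.mem_map_of_mem h)
  | andI _ _ ih₁ ih₂ => intro _ s; exact .andI (ih₁ s) (ih₂ s)
  | andE₁ _ ih => intro _ s; exact .andE₁ (ih s)
  | andE₂ _ ih => intro _ s; exact .andE₂ (ih s)
  | orI₁ _ ih => intro _ s; exact .orI₁ (ih s)
  | orI₂ _ ih => intro _ s; exact .orI₂ (ih s)
  | orE _ _ _ ih ih₁ ih₂ => intro _ s; exact .orE (ih s) (ih₁ s) (ih₂ s)
  | impI _ ih => intro _ s; exact .impI (ih s)
  | impE _ _ ih₁ ih₂ => intro _ s; exact .impE (ih₁ s) (ih₂ s)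
  | botE _ ih => intro _ s; exact .botE (ih s)
  | allI _ ih =>
    intro _ s
    refine .allI ?_
    rw [← map_wk_subst]
    exact ih _
  | allE t _ ih =>
    intro _ s
    rw [Fm.inst_subst]
    exact .allE _ (ih s)
  | exI t _ ih =>
    intro _ s
    refine .exI (t.subst s) ?_
    rw [← Fm.inst_subst]
    exact ih s
  | exE _ _ ih₁ ih₂ =>
    intro _ s
    refine .exE (ih₁ s) ?_
    have := ih₂ (s.lift _)
    rwa [Fm.wk_subst_lift, List.map_cons, map_wk_subst] at this
  | eqConv h => intro _ s; exact .eqConv (h.subst s)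
  | eqSubst A _ _ ih₁ ih₂ =>
    intro _ s
    have := ih₂ s
    rw [Fm.inst_subst] at this ⊢
    exact .eqSubst _ (ih₁ s) this
  | succ_inj _ ih => intro _ s; exact .succ_inj (ih s)
  | succ_ne_zero => intro _ s; exact .succ_ne_zero
  | ind A _ _ ih₁ ih₂ =>
    intro _ s
    refine .ind _ ?_ ?_
    · have := ih₁ s
      rwa [Fm.inst_subst] at this
    · have := ih₂ s
      simp only [Fm.subst, Fm.atSucc_subst] at this
      exact this
  | ac σ A h => intro _ s; rw [ac_subst]; exact .ac _ _ h
  | dns A h => intro _ s; rw [dns_subst]; exact .dns _ h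

theorem Prf.wk {Δ : Ctx} {L : List (Fm Δ)} {A : Fm Δ} (h : Prf R L A) (τ : Ty) :
    Prf R (L.map (Fm.wk τ)) (A.wk τ) :=
  h.subst _

theorem Prf.weaken {Δ : Ctx} {L : List (Fm Δ)} {A : Fm Δ} (h : Prf R L A) :
    ∀ {L' : List (Fm Δ)}, L ⊆ L' → Prf R L' A := by
  induction h with
  | ax h => intro _ s; exact .ax (s h)
  | andI _ _ ih₁ ih₂ => intro _ s; exact .andI (ih₁ s) (ih₂ s)
  | andE₁ _ ih => intro _ s; exact .andE₁ (ih s)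
  | andE₂ _ ih => intro _ s; exact .andE₂ (ih s)
  | orI₁ _ ih => intro _ s; exact .orI₁ (ih s)
  | orI₂ _ ih => intro _ s; exact .orI₂ (ih s)
  | orE _ _ _ ih ih₁ ih₂ =>
    intro _ s
    exact .orE (ih s) (ih₁ (List.cons_subset_cons _ s)) (ih₂ (List.cons_subset_cons _ s))
  | impI _ ih => intro _ s; exact .impI (ih (List.cons_subset_cons _ s))
  | impE _ _ ih₁ ih₂ => intro _ s; exact .impE (ih₁ s) (ih₂ s)
  | botE _ ih => intro _ s; exact .botE (ih s)
  | allI _ ih => intro _ s; exact .allI (ih (List.map_subset _ s))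
  | allE t _ ih => intro _ s; exact .allE _ (ih s)
  | exI t _ ih => intro _ s; exact .exI t (ih s)
  | exE _ _ ih₁ ih₂ =>
    intro _ s
    exact .exE (ih₁ s) (ih₂ (List.cons_subset_cons _ (List.map_subset _ s)))
  | eqConv h => intro _ s; exact .eqConv h
  | eqSubst A _ _ ih₁ ih₂ => intro _ s; exact .eqSubst _ (ih₁ s) (ih₂ s)
  | succ_inj _ ih => intro _ s; exact .succ_inj (ih s)
  | succ_ne_zero => intro _ s; exact .succ_ne_zero
  | ind A _ _ ih₁ ih₂ => intro _ s; exact .ind _ (ih₁ s) (ih₂ s)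
  | ac σ A h => intro _ s; exact .ac _ _ h
  | dns A h => intro _ s; exact .dns _ h

theorem Prf.weaken_cons {Δ : Ctx} {L : List (Fm Δ)} {A : Fm Δ} (h : Prf R L A) (B : Fm Δ) :
    Prf R (B :: L) A :=
  h.weaken (List.subset_cons_self _ _)

/-- A derivation may be continued from derivations of its assumptions. -/
theorem Prf.cut {Δ : Ctx} {L L' : List (Fm Δ)} {A : Fm Δ} (h : Prf R L A)
    (hL : ∀ B ∈ L, Prf R L' B) : Prf R L' A := by
  induction L generalizing A with
  | nil => exact h.weaken (List.nil_subset _)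
  | cons B L ih =>
    rw [List.forall_mem_cons] at hL
    exact .impE (ih (.impI h) hL.2) hL.1

theorem Prf.hyp {Δ : Ctx} {L : List (Fm Δ)} {A : Fm Δ} : Prf R (A :: L) A :=
  .ax List.mem_cons_self

/-- Weakening followed by instantiation with the new variable is the identity, so generalization is
invertible. -/
theorem Prf.all_open {Δ : Ctx} {L : List (Fm Δ)} {σ : Ty} {A : Fm (σ :: Δ)}
    (h : Prf R L (.all σ A)) : Prf R (L.map (Fm.wk σ)) A := by
  have := Prf.allE (.var .z) (h.wk σ)
  rwa [Fm.subst_lift_inst, ← Sub.lift, Sub.lift_id, Fm.subst_id] at this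

theorem Prf.eq_rw {Δ : Ctx} {L : List (Fm Δ)} {t u : Tm Δ Ty.nat} (A : Fm (Ty.nat :: Δ))
    {B C : Fm Δ} (h : Prf R L (.eq t u)) (hB : Prf R L B) (hBA : A.inst t = B)
    (hCA : A.inst u = C) : Prf R L C := by
  subst hBA hCA; exact .eqSubst A h hB

theorem Prf.eq_symm {Δ : Ctx} {L : List (Fm Δ)} {t u : Tm Δ Ty.nat}
    (h : Prf R L (.eq t u)) : Prf R L (.eq u t) :=
  Prf.eq_rw (.eq (.var .z) t.wk) h (.eqConv (.refl t))
    (by simp [Fm.inst, Fm.subst, Tm.subst, Sub.cons])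
    (by simp [Fm.inst, Fm.subst, Tm.subst, Sub.cons])

theorem Prf.eq_trans {Δ : Ctx} {L : List (Fm Δ)} {t u v : Tm Δ Ty.nat}
    (h : Prf R L (.eq t u)) (h' : Prf R L (.eq u v)) : Prf R L (.eq t v) :=
  Prf.eq_rw (.eq t.wk (.var .z)) h' h (by simp [Fm.inst, Fm.subst, Tm.subst, Sub.cons])
    (by simp [Fm.inst, Fm.subst, Tm.subst, Sub.cons])

/-- Case distinction on a natural number. -/
theorem Prf.nat_cases {Δ : Ctx} {L : List (Fm Δ)} (A : Fm (Ty.nat :: Δ)) (t : Tm Δ Ty.nat)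
    (h₀ : Prf R L (A.inst .zero)) (h₁ : Prf R (L.map (Fm.wk Ty.nat)) A.atSucc) :
    Prf R L (A.inst t) :=
  .allE t (.ind A h₀ (.allI (.impI (h₁.weaken_cons _))))

/-! ### Formulas derivable from the same assumptions -/

/-- Two formulas are interderivable. -/
def Fm.Equiv (R : Set Ty) {Δ : Ctx} (A B : Fm Δ) : Prop :=
  ∀ L : List (Fm Δ), Prf R L A ↔ Prf R L B

namespace Fm.Equiv

theorem symm {Δ : Ctx} {A B : Fm Δ} (h : A.Equiv R B) : B.Equiv R A := fun L => (h L).symm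

theorem eq {Δ : Ctx} {t t' u u' : Tm Δ Ty.nat} (ht : Conv t t') (hu : Conv u u') :
    (Fm.eq t u).Equiv R (Fm.eq t' u') := fun _ =>
  ⟨fun h => (Prf.eqConv ht.symm).eq_trans (h.eq_trans (.eqConv hu)),
    fun h => (Prf.eqConv ht).eq_trans (h.eq_trans (.eqConv hu.symm))⟩

theorem bot {Δ : Ctx} : (Fm.bot : Fm Δ).Equiv R Fm.bot := fun _ => Iff.rfl

theorem and {Δ : Ctx} {A A' B B' : Fm Δ} (hA : A.Equiv R A') (hB : B.Equiv R B') :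
    (Fm.and A B).Equiv R (Fm.and A' B') := fun _ =>
  ⟨fun h => .andI ((hA _).1 h.andE₁) ((hB _).1 h.andE₂),
    fun h => .andI ((hA _).2 h.andE₁) ((hB _).2 h.andE₂)⟩

theorem or {Δ : Ctx} {A A' B B' : Fm Δ} (hA : A.Equiv R A') (hB : B.Equiv R B') :
    (Fm.or A B).Equiv R (Fm.or A' B') := fun _ =>
  ⟨fun h => .orE h (.orI₁ ((hA _).1 .hyp)) (.orI₂ ((hB _).1 .hyp)),
    fun h => .orE h (.orI₁ ((hA _).2 .hyp)) (.orI₂ ((hB _).2 .hyp))⟩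

theorem imp {Δ : Ctx} {A A' B B' : Fm Δ} (hA : A.Equiv R A') (hB : B.Equiv R B') :
    (Fm.imp A B).Equiv R (Fm.imp A' B') := fun _ =>
  ⟨fun h => .impI ((hB _).1 (.impE (h.weaken_cons _) ((hA _).2 .hyp))),
    fun h => .impI ((hB _).2 (.impE (h.weaken_cons _) ((hA _).1 .hyp)))⟩

theorem all {Δ : Ctx} {σ : Ty} {A A' : Fm (σ :: Δ)} (hA : A.Equiv R A') :
    (Fm.all σ A).Equiv R (Fm.all σ A') := fun _ =>
  ⟨fun h => .allI ((hA _).1 h.all_open), fun h => .allI ((hA _).2 h.all_open)⟩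

theorem ex {Δ : Ctx} {σ : Ty} {A A' : Fm (σ :: Δ)} (hA : A.Equiv R A') :
    (Fm.ex σ A).Equiv R (Fm.ex σ A') := by
  have {L : List (Fm Δ)} {A A' : Fm (σ :: Δ)} (hA : A.Equiv R A') (h : Prf R L (.ex σ A)) :
      Prf R L (.ex σ A') := by
    refine .exE h (.exI (.var .z) ?_)
    rw [Fm.subst_lift_inst, ← Sub.lift, Sub.lift_id, Fm.subst_id]
    exact (hA _).1 .hyp
  exact fun _ => ⟨this hA, this hA.symm⟩

end Fm.Equiv

/-- Conversion enters the calculus only through equations of type `0`. Terms of every type occur in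
formulas only inside such equations, so invariance spreads from them by induction. -/
theorem Fm.subst_equiv {Γ : Ctx} (A : Fm Γ) :
    ∀ {Δ : Ctx} {s s' : Sub Γ Δ}, s.Conv s' → (A.subst s).Equiv R (A.subst s') := by
  induction A with
  | eq t u => intro _ _ _ h; exact .eq (t.subst_conv h) (u.subst_conv h)
  | bot => intros; exact .bot
  | and _ _ ih₁ ih₂ => intro _ _ _ h; exact .and (ih₁ h) (ih₂ h)
  | or _ _ ih₁ ih₂ => intro _ _ _ h; exact .or (ih₁ h) (ih₂ h)
  | imp _ _ ih₁ ih₂ => intro _ _ _ h; exact .imp (ih₁ h) (ih₂ h)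
  | all _ _ ih => intro _ _ _ h; exact .all (ih (h.lift _))
  | ex _ _ ih => intro _ _ _ h; exact .ex (ih (h.lift _))

/-! ### Realizability and substitution -/

/-- Lets realizers be computed up to conversion, so that projections of pairs and applied
abstractions can be reduced. -/
theorem mrt_equiv {Γ : Ctx} (A : Fm Γ) : ∀ {Δ : Ctx} {s s' : Sub Γ Δ} {t t' : Tm Δ A.rtype},
    s.Conv s' → Conv t t' → (mrt A s t).Equiv R (mrt A s' t') := by
  induction A with
  | eq t u => intro _ _ _ _ _ h _; exact .eq (t.subst_conv h) (u.subst_conv h)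
  | bot => intros; exact .bot
  | and _ _ ih₁ ih₂ => intro _ _ _ _ _ h ht; exact .and (ih₁ h ht.fst) (ih₂ h ht.snd)
  | or _ _ ih₁ ih₂ =>
    intro _ _ _ _ _ h ht
    exact .and (.imp (.eq ht.snd (.refl _)) (ih₁ h ht.fst.fst))
      (.imp (.imp (.eq ht.snd (.refl _)) .bot) (ih₂ h ht.fst.snd))
  | imp A B ih₁ ih₂ =>
    intro _ _ _ _ _ h ht
    exact .and (.all (.imp (ih₁ (h.wk _) (.refl _)) (ih₂ (h.wk _) ((ht.wk _).app (.refl _)))))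
      (.imp (A.subst_equiv h) (B.subst_equiv h))
  | all _ _ ih => intro _ _ _ _ _ h ht; exact .all (ih (h.lift _) ((ht.wk _).app (.refl _)))
  | ex _ _ ih => intro _ _ _ _ _ h ht; exact ih (h.cons ht.snd) ht.fst

theorem mrt_subst {Γ : Ctx} (A : Fm Γ) : ∀ {Δ Ξ : Ctx} (s : Sub Γ Δ) (t : Tm Δ A.rtype)
    (θ : Sub Δ Ξ), (mrt A s t).subst θ = mrt A (s.comp θ) (t.subst θ) := by
  induction A with
  | eq t u => intros; simp [mrt, Fm.subst, Tm.subst_subst]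
  | bot => intros; rfl
  | and _ _ ih₁ ih₂ => intro _ _ s t θ; exact congrArg₂ Fm.and (ih₁ s _ θ) (ih₂ s _ θ)
  | or _ _ ih₁ ih₂ =>
    intro _ _ s t θ
    exact congrArg₂ Fm.and (congrArg (Fm.imp _) (ih₁ s _ θ)) (congrArg (Fm.imp _) (ih₂ s _ θ))
  | imp A B ih₁ ih₂ =>
    intro _ _ s t θ
    refine congrArg₂ Fm.and (congrArg (Fm.all _) (congrArg₂ Fm.imp ((ih₁ _ _ _).trans ?_)
      ((ih₂ _ _ _).trans ?_))) (congrArg₂ Fm.imp (A.subst_subst _ _) (B.subst_subst _ _))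
    · exact congrArg (mrt A · _) (Sub.wk_comp_lift s θ)
    · exact congrArg₂ (mrt B) (Sub.wk_comp_lift s θ)
        (congrArg (Tm.app · _) (Tm.wk_subst_lift _ θ A.rtype))
  | all σ A ih =>
    intro _ _ s t θ
    refine congrArg (Fm.all σ) ((ih _ _ _).trans ?_)
    exact congrArg₂ (mrt A) (Sub.lift_comp s θ σ).symm
      (congrArg (Tm.app · _) (Tm.wk_subst_lift _ θ σ))
  | ex σ A ih =>
    intro _ _ s t θ
    exact (ih _ _ _).trans (congrArg (mrt A · _) (Sub.cons_comp _ s θ))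

theorem Fm.rtype_subst {Γ : Ctx} (A : Fm Γ) :
    ∀ {Δ : Ctx} (s : Sub Γ Δ), (A.subst s).rtype = A.rtype := by
  induction A <;> intros <;> simp_all [Fm.subst, Fm.rtype]

/-- Transport of a term along an equation between types. -/
def Tm.cast {Δ : Ctx} {σ τ : Ty} (h : σ = τ) (t : Tm Δ σ) : Tm Δ τ := h ▸ t

theorem Tm.fst_cast {Δ : Ctx} {σ σ' τ τ' : Ty} (hσ : σ = σ') (hτ : τ = τ')
    (h : Ty.prod σ τ = Ty.prod σ' τ') (t : Tm Δ (Ty.prod σ τ)) :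
    Tm.fst (t.cast h) = (Tm.fst t).cast hσ := by
  subst hσ hτ; rfl

theorem Tm.snd_cast {Δ : Ctx} {σ σ' τ τ' : Ty} (hσ : σ = σ') (hτ : τ = τ')
    (h : Ty.prod σ τ = Ty.prod σ' τ') (t : Tm Δ (Ty.prod σ τ)) :
    Tm.snd (t.cast h) = (Tm.snd t).cast hτ := by
  subst hσ hτ; rfl

theorem Tm.app_wk_cast {Δ : Ctx} {σ τ τ' : Ty} (hτ : τ = τ')
    (h : Ty.arr σ τ = Ty.arr σ τ') (t : Tm Δ (Ty.arr σ τ)) :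
    Tm.app (Tm.wk (t.cast h)) (.var (.z : Var (σ :: Δ) σ)) =
      (Tm.app t.wk (.var .z)).cast hτ := by
  subst hτ; rfl

/-- Realizability of `A[s]` under `θ` is realizability of `A` under the composition. -/
theorem mrt_comp {Γ : Ctx} (A : Fm Γ) : ∀ {Δ Ξ : Ctx} (s : Sub Γ Δ) (θ : Sub Δ Ξ)
    (t : Tm Ξ (A.subst s).rtype),
    mrt (A.subst s) θ t = mrt A (s.comp θ) (t.cast (A.rtype_subst s)) := by
  induction A with
  | eq t u => intros; simp [mrt, Fm.subst, Tm.subst_subst]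
  | bot => intros; rfl
  | and A B ih₁ ih₂ =>
    intro _ _ s θ t
    have hA := A.rtype_subst s
    have hB := B.rtype_subst s
    exact congrArg₂ Fm.and
      ((ih₁ s θ _).trans (congrArg (mrt A _) (Tm.fst_cast hA hB _ t).symm))
      ((ih₂ s θ _).trans (congrArg (mrt B _) (Tm.snd_cast hA hB _ t).symm))
  | or A B ih₁ ih₂ =>
    intro _ _ s θ t
    have hA := A.rtype_subst s
    have hB := B.rtype_subst s
    have h : Ty.prod (A.subst s).rtype (B.subst s).rtype = Ty.prod A.rtype B.rtype := by
      rw [hA, hB]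
    have h₁ := Tm.fst_cast h rfl (Fm.rtype_subst (.or A B) s) t
    have h₂ := Tm.snd_cast h rfl (Fm.rtype_subst (.or A B) s) t
    refine congrArg₂ Fm.and (congrArg₂ Fm.imp ?_ ((ih₁ s θ _).trans ?_))
      (congrArg₂ Fm.imp (congrArg Fm.neg ?_) ((ih₂ s θ _).trans ?_))
    · exact congrArg (Fm.eq · _) h₂.symm
    · exact congrArg (mrt A _) ((congrArg Tm.fst h₁).trans (Tm.fst_cast hA hB h _)).symm
    · exact congrArg (Fm.eq · _) h₂.symm
    · exact congrArg (mrt B _) ((congrArg Tm.snd h₁).trans (Tm.snd_cast hA hB h _)).symm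
  | imp A B ih₁ ih₂ =>
    intro _ _ s θ t
    -- The two realizer types are equal but not definitionally so, and one of them is the domain of
    -- a quantifier. Generalizing both to variables lets the equations be eliminated.
    have key : ∀ {ρ τ : Ty} (hρ : ρ = A.rtype) (hτ : τ = B.rtype)
        (h : Ty.arr ρ τ = Ty.arr A.rtype B.rtype) (t : Tm _ (Ty.arr ρ τ)),
        Fm.all ρ (.imp (mrt A (s.comp (θ.wk ρ)) ((Tm.var .z).cast hρ))
            (mrt B (s.comp (θ.wk ρ)) ((Tm.app t.wk (.var .z)).cast hτ))) =
          Fm.all A.rtype (.imp (mrt A ((s.comp θ).wk A.rtype) (.var .z))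
            (mrt B ((s.comp θ).wk A.rtype) (.app (t.cast h).wk (.var .z)))) := by
      intro ρ τ hρ hτ h t
      subst hρ hτ
      rw [Sub.comp_wk]
      rfl
    exact congrArg₂ Fm.and ((congrArg (Fm.all _) (congrArg₂ Fm.imp (ih₁ _ _ _) (ih₂ _ _ _))).trans
      (key (A.rtype_subst s) (B.rtype_subst s) _ t))
      (congrArg₂ Fm.imp (A.subst_subst _ _) (B.subst_subst _ _))
  | all σ A ih =>
    intro _ _ s θ t
    refine congrArg (Fm.all σ) ((ih _ _ _).trans ?_)
    exact congrArg₂ (mrt A) (Sub.lift_comp s θ σ).symm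
      (Tm.app_wk_cast (A.rtype_subst _) (Fm.rtype_subst (.all σ A) s) t).symm
  | ex σ A ih =>
    intro _ _ s θ t
    refine (ih _ _ _).trans (congrArg₂ (mrt A) ((Sub.lift_comp_cons _ _ _).trans ?_) ?_)
    · exact congrArg (Sub.cons · _)
        (Tm.snd_cast (A.rtype_subst _) rfl (Fm.rtype_subst (.ex σ A) s) t).symm
    · exact (Tm.fst_cast (A.rtype_subst _) rfl (Fm.rtype_subst (.ex σ A) s) t).symm

/-! ### Realizability implies truth -/

/-- Elimination of a disjunction that is given by a number deciding between its two sides. -/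
theorem Prf.decide_elim {Δ : Ctx} {L : List (Fm Δ)} {A B : Fm Δ} (C : Fm (Ty.nat :: Δ))
    (n : Tm Δ Ty.nat) (hA : Prf R L (.imp (.eq n .zero) A))
    (hB : Prf R L (.imp (Fm.eq n .zero).neg B)) (h₀ : Prf R (A :: L) (C.inst .zero))
    (h₁ : Prf R ((B :: L).map (Fm.wk Ty.nat)) C.atSucc) : Prf R L (C.inst n) := by
  -- Both implications mention `n`, so they go into the formula on which the case distinction is
  -- made; each case then discharges the one whose premise has become provable.
  have h := Prf.nat_cases (R := R) (L := L)
    (.imp (.imp (.eq (.var .z) .zero) (A.wk _))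
      (.imp (.imp (Fm.eq (.var .z) .zero).neg (B.wk _)) C)) n ?_ ?_
  · simp only [Fm.inst, Fm.subst, Fm.neg, Tm.subst, Fm.wk_subst_cons, Sub.cons,
      Fm.subst_id] at h
    exact .impE (.impE h hA) hB
  · simp only [Fm.inst, Fm.subst, Fm.neg, Tm.subst, Fm.wk_subst_cons, Sub.cons, Fm.subst_id]
    refine .impI (.impI (h₀.cut (List.forall_mem_cons.2 ⟨?_, fun D hD => ?_⟩)))
    · exact .impE (Prf.weaken_cons .hyp _) (.eqConv (.refl _))
    · exact .ax (by simp [hD])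
  · simp only [Fm.atSucc, Fm.subst, Fm.neg, Tm.subst, Fm.wk_subst_cons, Sub.cons]
    refine .impI (.impI (h₁.cut (List.forall_mem_cons.2 ⟨?_, fun D hD => ?_⟩)))
    · exact .impE .hyp .succ_ne_zero
    · exact .ax (List.mem_cons_of_mem _ (List.mem_cons_of_mem _ hD))

theorem mrt_wk {Γ Δ : Ctx} (A : Fm Γ) (s : Sub Γ Δ) (t : Tm Δ A.rtype) (τ : Ty) :
    (mrt A s t).wk τ = mrt A (s.wk τ) t.wk := by
  rw [Fm.wk, mrt_subst, Sub.comp_wk, Sub.comp_id, ← Tm.wk_eq_subst]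

/-- For implication, truth is the second conjunct of the clause. For disjunction, the selecting
number is zero or a successor, and either case gives one side. -/
theorem Prf.truth_of_mrt {Γ : Ctx} {A : Fm Γ} : ∀ {Δ : Ctx} {L : List (Fm Δ)} {s : Sub Γ Δ}
    {t : Tm Δ A.rtype}, Prf R L (mrt A s t) → Prf R L (A.subst s) := by
  induction A with
  | eq t u => intro _ _ _ _ h; exact h
  | bot => intro _ _ _ _ h; exact h
  | and A B ih₁ ih₂ => intro _ _ _ _ h; exact .andI (ih₁ h.andE₁) (ih₂ h.andE₂)
  | or A B ih₁ ih₂ =>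
    intro _ L s t h
    have := Prf.decide_elim ((Fm.or A B).subst s |>.wk _) _ h.andE₁ h.andE₂ ?_ ?_
    · rwa [Fm.wk_inst] at this
    · rw [Fm.wk_inst]
      exact .orI₁ (ih₁ .hyp)
    · rw [Fm.atSucc, Fm.wk_subst_cons]
      exact Prf.wk (.orI₂ (ih₂ .hyp)) _
  | imp A B ih₁ ih₂ => intro _ _ _ _ h; exact h.andE₂
  | all σ A ih => intro _ _ _ _ h; exact .allI (ih h.all_open)
  | ex σ A ih =>
    intro _ _ s t h
    refine .exI (.snd t) ?_
    rw [Fm.subst_lift_inst]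
    exact ih h

/-! ### Realizable formulas -/

/-- The clauses for `→` and `∀` apply a weakened realizer to the newest variable; for an abstraction
this gives back the body. -/
theorem Conv.app_lam_wk {Δ : Ctx} {σ τ : Ty} (t : Tm (σ :: Δ) τ) :
    Conv (.app (Tm.lam t).wk (.var .z)) t := by
  refine .trans (.of_eq ?_) ((Conv.beta (t.subst (((Sub.id Δ).wk σ).lift σ)) (.var .z)).trans
    (.of_eq ?_))
  · rw [Tm.wk_eq_subst]; rfl
  · rw [Tm.inst, Tm.subst_subst, Sub.lift_comp_cons, Sub.comp_id, ← Sub.lift, Sub.lift_id,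
      Tm.subst_id]

/-- Supplies dummy realizers, after falsity and for the side of a disjunction that is not chosen. -/
theorem Tm.nonempty : ∀ (σ : Ty) (Δ : Ctx), Nonempty (Tm Δ σ)
  | .nat, _ => ⟨.zero⟩
  | .unit, _ => ⟨.star⟩
  | .prod σ τ, Δ => (Tm.nonempty σ Δ).elim fun t => (Tm.nonempty τ Δ).elim fun u => ⟨.pair t u⟩
  | .arr σ τ, Δ => (Tm.nonempty τ (σ :: Δ)).elim fun t => ⟨.lam t⟩

/-- Under the assumptions `L`, some term provably realizes `A[s]`. -/
def Realizable (R : Set Ty) {Γ Δ : Ctx} (L : List (Fm Δ)) (A : Fm Γ) (s : Sub Γ Δ) : Prop :=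
  ∃ t, Prf R L (mrt A s t)

namespace Realizable

variable {Γ Δ : Ctx} {L : List (Fm Δ)} {s : Sub Γ Δ}

theorem truth {A : Fm Γ} (h : Realizable R L A s) : Prf R L (A.subst s) :=
  h.elim fun _ => Prf.truth_of_mrt

theorem weaken {L' : List (Fm Δ)} {A : Fm Γ} (h : Realizable R L A s) (hL : L ⊆ L') :
    Realizable R L' A s :=
  h.imp fun _ h => h.weaken hL

theorem conv {A : Fm Γ} {s' : Sub Γ Δ} (h : Realizable R L A s) (hs : s.Conv s') :
    Realizable R L A s' :=
  h.imp fun _ h => (mrt_equiv A hs (.refl _) L).1 h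

theorem wk {A : Fm Γ} (h : Realizable R L A s) (τ : Ty) :
    Realizable R (L.map (Fm.wk τ)) A (s.wk τ) := by
  obtain ⟨t, h⟩ := h
  exact ⟨t.wk, by rw [← mrt_wk]; exact h.wk τ⟩

/-- Since the realizer is existentially quantified, the transport between realizer types stays
hidden here and does not reach the soundness proof. -/
theorem subst_iff {Ξ : Ctx} {A : Fm Ξ} {θ : Sub Ξ Γ} :
    Realizable R L (A.subst θ) s ↔ Realizable R L A (θ.comp s) := by
  constructor
  · rintro ⟨t, h⟩
    exact ⟨_, by rwa [mrt_comp] at h⟩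
  · rintro ⟨t, h⟩
    refine ⟨t.cast (A.rtype_subst θ).symm, ?_⟩
    rw [mrt_comp]
    have key : ∀ {σ τ : Ty} (h : τ = σ) (h' : σ = τ) (t : Tm Δ τ), (t.cast h).cast h' = t := by
      intro σ τ h _ t; subst h; rfl
    rwa [key]

theorem inst_iff {τ : Ty} {A : Fm (τ :: Γ)} {u : Tm Γ τ} :
    Realizable R L (A.inst u) s ↔ Realizable R L A (Sub.cons (u.subst s) s) := by
  rw [Fm.inst, subst_iff, Sub.cons_comp, Sub.id_comp]

theorem wk_iff {τ : Ty} {A : Fm Γ} {u : Tm Δ τ} :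
    Realizable R L (A.wk τ) (Sub.cons u s) ↔ Realizable R L A s := by
  rw [Fm.wk, subst_iff, Sub.wk_comp_cons, Sub.id_comp]

theorem hyp {A : Fm Γ} {t : Tm Δ A.rtype} : Realizable R (mrt A s t :: L) A s := ⟨t, .hyp⟩

/-- The realizer of an assumption may be instantiated. -/
theorem inst_hyp {A C : Fm Γ} {c : Tm (A.rtype :: Δ) C.rtype}
    (h : Prf R (mrt A (s.wk A.rtype) (.var .z) :: L.map (Fm.wk A.rtype))
      (mrt C (s.wk A.rtype) c)) (u : Tm Δ A.rtype) :
    Prf R (mrt A s u :: L) (mrt C s (c.inst u)) := by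
  have h' := Prf.allE u (.allI (.impI h))
  rw [Fm.inst, Fm.subst, mrt_subst, mrt_subst, Sub.wk_comp_cons, Sub.comp_id] at h'
  exact .impE (h'.weaken_cons _) .hyp

theorem bot_elim {A : Fm Γ} (h : Prf R L .bot) : Realizable R L A s :=
  (Tm.nonempty A.rtype Δ).elim fun t => ⟨t, .botE h⟩

theorem and_intro {A B : Fm Γ} (hA : Realizable R L A s) (hB : Realizable R L B s) :
    Realizable R L (.and A B) s := by
  obtain ⟨t, ht⟩ := hA
  obtain ⟨u, hu⟩ := hB
  exact ⟨.pair t u, .andI ((mrt_equiv A (.refl s) (.symm (.fst_pair t u)) L).1 ht)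
    ((mrt_equiv B (.refl s) (.symm (.snd_pair t u)) L).1 hu)⟩

/-- The truth conjunct does not follow from the realizability of `B`, so it has to be supplied
separately. -/
theorem imp_intro {A B : Fm Γ}
    (h : Realizable R (mrt A (s.wk A.rtype) (.var .z) :: L.map (Fm.wk A.rtype)) B (s.wk A.rtype))
    (htruth : Prf R L ((Fm.imp A B).subst s)) : Realizable R L (.imp A B) s := by
  obtain ⟨t, ht⟩ := h
  exact ⟨.lam t, .andI
    (.allI (.impI ((mrt_equiv B (.refl _) (.symm (.app_lam_wk t)) _).1 ht))) htruth⟩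

theorem imp_elim {A B : Fm Γ} (h : Realizable R L (.imp A B) s) (hA : Realizable R L A s) :
    Realizable R L B s := by
  obtain ⟨t, ht⟩ := h
  obtain ⟨u, hu⟩ := hA
  have := Prf.allE u ht.andE₁
  rw [Fm.inst, Fm.subst, mrt_subst, mrt_subst, Sub.wk_comp_cons, Sub.comp_id] at this
  exact ⟨_, .impE this hu⟩

/-- A realizer of `A` would make `A` true, against the negation. Falsity has realizers of unit type,
so the realizer carries no information. -/
theorem neg_intro {A : Fm Γ} (h : Prf R L (A.neg.subst s)) : Realizable R L A.neg s := by
  refine imp_intro ⟨.star, ?_⟩ h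
  refine .impE (Prf.weaken_cons ?_ _) (Prf.truth_of_mrt .hyp)
  rw [Fm.subst_wk]
  exact h.wk _

theorem all_intro {σ : Ty} {A : Fm (σ :: Γ)}
    (h : Realizable R (L.map (Fm.wk σ)) A (s.lift σ)) : Realizable R L (.all σ A) s := by
  obtain ⟨t, ht⟩ := h
  exact ⟨.lam t, .allI ((mrt_equiv A (.refl _) (.symm (.app_lam_wk t)) _).1 ht)⟩

theorem all_elim {σ : Ty} {A : Fm (σ :: Γ)} (h : Realizable R L (.all σ A) s) (u : Tm Δ σ) :
    Realizable R L A (Sub.cons u s) := by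
  obtain ⟨t, ht⟩ := h
  have := Prf.allE u ht
  rw [Fm.inst, mrt_subst, Sub.lift_comp_cons, Sub.comp_id] at this
  exact ⟨_, this⟩

theorem ex_intro {σ : Ty} {A : Fm (σ :: Γ)} (u : Tm Δ σ)
    (h : Realizable R L A (Sub.cons u s)) : Realizable R L (.ex σ A) s := by
  obtain ⟨t, ht⟩ := h
  exact ⟨.pair t u, (mrt_equiv A (.cons (.refl s) (.symm (.snd_pair t u)))
    (.symm (.fst_pair t u)) L).1 ht⟩

theorem ex_elim {σ : Ty} {A : Fm (σ :: Γ)} (h : Realizable R L (.ex σ A) s) :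
    ∃ u : Tm Δ σ, Realizable R L A (Sub.cons u s) := by
  obtain ⟨t, ht⟩ := h
  exact ⟨.snd t, .fst t, ht⟩

theorem or_intro_left {A B : Fm Γ} (hA : Realizable R L A s) : Realizable R L (.or A B) s := by
  obtain ⟨t, ht⟩ := hA
  obtain ⟨u⟩ := Tm.nonempty B.rtype Δ
  -- The selector `0` chooses the left side; `u` is a dummy.
  refine ⟨.pair (.pair t u) .zero, .andI (.impI (Prf.weaken_cons ?_ _)) (.impI (.botE
    (.impE .hyp (.eqConv (.snd_pair _ _)))))⟩
  exact (mrt_equiv A (.refl s) ((Conv.fst (.fst_pair _ _)).trans (.fst_pair t u)) L).2 ht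

theorem or_intro_right {A B : Fm Γ} (hB : Realizable R L B s) : Realizable R L (.or A B) s := by
  obtain ⟨t, ht⟩ := hB
  obtain ⟨u⟩ := Tm.nonempty A.rtype Δ
  refine ⟨.pair (.pair u t) (.succ .zero), .andI (.impI (.botE
    (.impE .succ_ne_zero (.eq_trans (.eq_symm (.eqConv (.snd_pair _ _))) .hyp))))
    (.impI (Prf.weaken_cons ?_ _))⟩
  exact (mrt_equiv B (.refl s) ((Conv.snd (.fst_pair _ _)).trans (.snd_pair u t)) L).2 ht

/-- The realizer is a definition by cases on the selecting number: a recursor whose step ignores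
both the predecessor and the previous value. -/
theorem or_elim {A B C : Fm Γ} (h : Realizable R L (.or A B) s)
    (hA : Realizable R (mrt A (s.wk A.rtype) (.var .z) :: L.map (Fm.wk A.rtype))
      C (s.wk A.rtype))
    (hB : Realizable R (mrt B (s.wk B.rtype) (.var .z) :: L.map (Fm.wk B.rtype))
      C (s.wk B.rtype)) : Realizable R L C s := by
  obtain ⟨t, ht⟩ := h
  obtain ⟨a, ha⟩ := hA
  obtain ⟨b, hb⟩ := hB
  let a' := a.inst (.fst (.fst t))
  let b' := b.inst (.snd (.fst t))
  let f : Tm Δ (.arr .nat (.arr C.rtype C.rtype)) := .lam (.lam b'.wk.wk)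
  have ha' : Prf R (mrt A s (.fst (.fst t)) :: L) (mrt C s a') := inst_hyp ha _
  have hb' : Prf R (mrt B s (.snd (.fst t)) :: L) (mrt C s b') := inst_hyp hb _
  have := Prf.decide_elim (mrt C (s.wk Ty.nat) (.natRec a'.wk f.wk (.var .z))) (.snd t)
    ht.andE₁ ht.andE₂ ?_ ?_
  · rw [Fm.inst, mrt_subst, Sub.wk_comp_cons, Sub.comp_id] at this
    exact ⟨_, this⟩
  · rw [Fm.inst, mrt_subst, Sub.wk_comp_cons, Sub.comp_id]
    refine (mrt_equiv C (.refl s) ?_ _).1 ha'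
    simp only [Tm.subst, Tm.wk_subst_cons, Tm.subst_id, Sub.cons]
    exact (Conv.natRec_zero _ _).symm
  · rw [Fm.atSucc, mrt_subst, Sub.wk_comp_cons, Sub.comp_wk, Sub.comp_id]
    have := hb'.wk Ty.nat
    rw [mrt_wk] at this
    refine (mrt_equiv C (.refl _) ?_ _).1 this
    simp only [Tm.subst, Tm.wk_subst_cons, Sub.cons, ← Tm.wk_eq_subst]
    refine .symm ((Conv.natRec_succ _ _ _).trans ?_)
    refine (Conv.app (.app_lam_wk _) (.refl _)).trans ((Conv.beta _ _).trans (.of_eq ?_))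
    exact Tm.wk_inst _ _

/-- The realizer is given by primitive recursion, and induction inside the calculus proves that it
realizes `A`. -/
theorem ind {A : Fm (Ty.nat :: Γ)} (h₀ : Realizable R L A (Sub.cons .zero s))
    (h₁ : Realizable R (L.map (Fm.wk Ty.nat)) (.imp A A.atSucc) (s.lift Ty.nat)) :
    Realizable R (L.map (Fm.wk Ty.nat)) A (s.lift Ty.nat) := by
  obtain ⟨a, ha⟩ := h₀
  -- In `t` the newest variable is a realizer of `A(x)` and the next one is `x` itself; abstracting
  -- both gives the step of the recursor.
  obtain ⟨t, ht⟩ : Realizable R (mrt A ((s.lift Ty.nat).wk A.rtype) (.var .z) ::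
      (L.map (Fm.wk Ty.nat)).map (Fm.wk A.rtype)) A
      ((Sub.cons (.succ (.var .z)) (s.wk Ty.nat)).wk A.rtype) := by
    have := imp_elim ((h₁.wk A.rtype).weaken (List.subset_cons_self _ _))
      (hyp (t := .var .z))
    rw [Fm.atSucc, subst_iff] at this
    refine this.conv fun σ x => .of_eq ?_
    cases x with
    | z => rfl
    | s x => simp [Sub.comp, Sub.cons, Sub.wk, Tm.subst, Sub.id, Sub.lift, Tm.wk, Tm.rename]
  let f : Tm Δ (.arr .nat (.arr A.rtype A.rtype)) := .lam (.lam t)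
  let r : Tm (Ty.nat :: Δ) A.rtype := .natRec a.wk f.wk (.var .z)
  refine ⟨r, Prf.all_open (Prf.ind _ ?_ (.allI ?_))⟩
  · rw [Fm.inst, mrt_subst, Sub.lift_comp_cons, Sub.comp_id]
    refine (mrt_equiv A (.refl _) ?_ L).1 ha
    simp only [r, Tm.subst, Tm.wk_subst_cons, Tm.subst_id, Sub.cons]
    exact (Conv.natRec_zero _ _).symm
  · have := Prf.allE r (.allI (.impI ht))
    rw [Fm.inst, Fm.subst, mrt_subst, mrt_subst, Sub.wk_comp_cons, Sub.wk_comp_cons,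
      Sub.comp_id, Sub.comp_id] at this
    rw [Fm.atSucc, mrt_subst, Sub.lift_comp_cons, Sub.comp_wk, Sub.comp_id]
    refine .impI ((mrt_equiv A (.refl _) ?_ _).1 (.impE (this.weaken_cons _) .hyp))
    simp only [r, Tm.subst, Tm.wk_subst_cons, Sub.cons, ← Tm.wk_eq_subst]
    refine .symm ((Conv.natRec_succ _ _ _).trans ?_)
    exact (Conv.app (.app_lam_wk _) (.refl _)).trans (Conv.beta _ _)

/-- A realizer `f` of the premise maps `x` to a realizer paired with a witness. The second
projections form the choice function, and the first ones realize its correctness. -/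
theorem ac {ρ : Ty} (hρ : ρ ∈ R) (σ : Ty) (A : Fm (σ :: ρ :: Γ)) :
    Realizable R L (ac ρ σ A) s := by
  refine imp_intro ?_ ?_
  · set T := (Fm.all ρ (.ex σ A)).rtype
    set θ := s.wk T
    let f : Tm (T :: Δ) (.arr ρ (.prod A.rtype σ)) := .var .z
    -- This is the definitional unfolding of the realizability of the premise.
    have hf : Prf R (mrt (.all ρ (.ex σ A)) θ f :: L.map (Fm.wk T))
      (.all ρ (mrt A (Sub.cons (.snd (.app f.wk (.var .z))) (θ.lift ρ))
        (.fst (.app f.wk (.var .z))))) := .hyp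
    refine ex_intro (.lam (.snd (.app f.wk (.var .z)))) (all_intro ?_)
    rw [Fm.atApp, subst_iff]
    refine Realizable.conv ⟨_, hf.all_open⟩ ?_
    simp only [Sub.cons_comp, Tm.subst, Sub.wk_comp_lift, Sub.wk_comp_cons, Sub.id_comp]
    exact .cons (.refl _) (.symm (.app_lam_wk _))
  · have : Prf R L ((HAOmega.ac ρ σ A).subst s) := by rw [ac_subst]; exact .ac _ _ hρ
    exact this

/-- The conclusion is a negation, so only its truth matters; DNS itself gives that from the truth of
the realized premise. -/
theorem dns {ρ : Ty} (hρ : ρ ∈ R) (A : Fm (ρ :: Γ)) : Realizable R L (dns ρ A) s := by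
  refine imp_intro (neg_intro ?_) (.dns _ hρ)
  exact .impE (.dns _ hρ) (Prf.truth_of_mrt .hyp)

end Realizable

/-! ### Soundness -/

/-- Supplies the truth conjunct when an implication is introduced. -/
theorem Prf.subst_of_realizable {Γ Δ : Ctx} {L : List (Fm Γ)} {A : Fm Γ} (h : Prf R L A)
    {s : Sub Γ Δ} {L' : List (Fm Δ)} (hL : ∀ B ∈ L, Realizable R L' B s) :
    Prf R L' (A.subst s) := by
  refine (h.subst s).cut fun B hB => ?_
  obtain ⟨B, hB', rfl⟩ := List.mem_map.1 hB
  exact (hL B hB').truth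

theorem realizable_cons {Γ Δ : Ctx} {L : List (Fm Γ)} {s : Sub Γ Δ} {L' : List (Fm Δ)}
    (hL : ∀ B ∈ L, Realizable R L' B s) (A : Fm Γ) :
    ∀ B ∈ A :: L, Realizable R (mrt A (s.wk A.rtype) (.var .z) :: L'.map (Fm.wk A.rtype))
      B (s.wk A.rtype) :=
  List.forall_mem_cons.2
    ⟨.hyp, fun B hB => ((hL B hB).wk _).weaken (List.subset_cons_self _ _)⟩

theorem realizable_map_wk {Γ Δ : Ctx} {L : List (Fm Γ)} {s : Sub Γ Δ} {L' : List (Fm Δ)}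
    (hL : ∀ B ∈ L, Realizable R L' B s) {τ : Ty} (u : Tm Δ τ) :
    ∀ B ∈ L.map (Fm.wk τ), Realizable R L' B (Sub.cons u s) := by
  intro B hB
  obtain ⟨B, hB', rfl⟩ := List.mem_map.1 hB
  exact Realizable.wk_iff.2 (hL B hB')

/-- Soundness of modified realizability with truth. -/
theorem Prf.realizable {Γ : Ctx} {L : List (Fm Γ)} {A : Fm Γ} (h : Prf R L A) :
    ∀ {Δ : Ctx} {s : Sub Γ Δ} {L' : List (Fm Δ)}, (∀ B ∈ L, Realizable R L' B s) →
      Realizable R L' A s := by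
  induction h with
  | ax h => intro _ _ _ hL; exact hL _ h
  | andI _ _ ih₁ ih₂ => intro _ _ _ hL; exact .and_intro (ih₁ hL) (ih₂ hL)
  | andE₁ _ ih => intro _ _ _ hL; exact (ih hL).elim fun t h => ⟨.fst t, h.andE₁⟩
  | andE₂ _ ih => intro _ _ _ hL; exact (ih hL).elim fun t h => ⟨.snd t, h.andE₂⟩
  | orI₁ _ ih => intro _ _ _ hL; exact .or_intro_left (ih hL)
  | orI₂ _ ih => intro _ _ _ hL; exact .or_intro_right (ih hL)
  | orE _ _ _ ih ih₁ ih₂ =>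
    intro _ _ _ hL
    exact .or_elim (ih hL) (ih₁ (realizable_cons hL _)) (ih₂ (realizable_cons hL _))
  | impI h ih =>
    intro _ _ _ hL
    -- The truth conjunct is the derivation under analysis, its assumptions being true because they
    -- are realized.
    exact .imp_intro (ih (realizable_cons hL _)) ((Prf.impI h).subst_of_realizable hL)
  | impE _ _ ih₁ ih₂ => intro _ _ _ hL; exact .imp_elim (ih₁ hL) (ih₂ hL)
  | botE _ ih => intro _ _ _ hL; exact .bot_elim (ih hL).truth
  | allI _ ih =>
    intro _ _ _ hL
    exact .all_intro (ih (realizable_map_wk (fun B hB => (hL B hB).wk _) _))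
  | allE t _ ih => intro _ _ _ hL; exact Realizable.inst_iff.2 ((ih hL).all_elim _)
  | exI t _ ih => intro _ _ _ hL; exact .ex_intro _ (Realizable.inst_iff.1 (ih hL))
  | exE _ _ ih₁ ih₂ =>
    intro _ _ _ hL
    -- The induction hypothesis holds for every substitution, so the eigenvariable is replaced by
    -- the extracted witness and the calculus needs no existential elimination.
    obtain ⟨u, hu⟩ := (ih₁ hL).ex_elim
    exact Realizable.wk_iff.1 (ih₂ (List.forall_mem_cons.2 ⟨hu, realizable_map_wk hL u⟩))
  | eqConv h => intro _ s _ _; exact ⟨.star, .eqConv (h.subst s)⟩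
  | @eqSubst _ _ t u A _ _ ih₁ ih₂ =>
    intro _ s _ hL
    obtain ⟨r, hr⟩ := Realizable.inst_iff.1 (ih₂ hL)
    -- Realizer types do not depend on the terms in a formula, so the same `r` serves both
    -- instances.
    refine Realizable.inst_iff.2 ⟨r, (ih₁ hL).truth.eq_rw (mrt A (s.lift _) r.wk) hr ?_ ?_⟩ <;>
    · rw [Fm.inst, mrt_subst, Sub.lift_comp_cons, Sub.comp_id, Tm.wk_subst_cons, Tm.subst_id]
  | succ_inj _ ih => intro _ _ _ hL; exact ⟨.star, .succ_inj (ih hL).truth⟩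
  | succ_ne_zero => intro _ _ _ _; exact .neg_intro .succ_ne_zero
  | ind A _ _ ih₁ ih₂ =>
    intro _ _ _ hL
    refine .all_intro (.ind (Realizable.inst_iff.1 (ih₁ hL)) ?_)
    exact ((ih₂ hL).wk _).all_elim (.var .z)
  | ac σ A h => intros; exact .ac h σ A
  | dns A h => intros; exact .dns h A

theorem realizable_mrtCtx {Δ : Ctx} (L : List (Fm Δ)) :
    ∀ B ∈ L, Realizable R (mrtCtx L) B (realWk L) := by
  induction L with
  | nil => simp
  | cons A L ih => exact realizable_cons ih A

/-- Existence property for open formulas under assumptions. -/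
theorem Prf.existence {Δ : Ctx} {L : List (Fm Δ)} {τ : Ty} {A : Fm (τ :: Δ)}
    (h : Prf R L (.ex τ A)) :
    ∃ t : Tm (realCtx L) τ, Prf R (mrtCtx L) (A.subst (Sub.cons t (realWk L))) :=
  (h.realizable (realizable_mrtCtx L)).ex_elim.imp fun _ => Realizable.truth

open Nat.Partrec (Code)

/-! ### Terms denote recursive functions -/

/-- The number `n` codes the closed term `t` hereditarily: as its value at type `0`, and as an
index of a partial recursive function that maps codes to codes at arrow types. -/
def Computes : (σ : Ty) → Tm [] σ → ℕ → Prop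
  | .nat, t, n => Conv t (num n)
  | .unit, _, _ => True
  | .prod σ τ, t, n => Computes σ (.fst t) n.unpair.1 ∧ Computes τ (.snd t) n.unpair.2
  | .arr σ τ, t, n => ∀ u a, Computes σ u a →
      ∃ b ∈ (Denumerable.ofNat Code n).eval a, Computes τ (.app t u) b

theorem Computes.conv : ∀ {σ : Ty} {t u : Tm [] σ} {n : ℕ}, Computes σ t n → Conv t u →
    Computes σ u n
  | .nat, _, _, _, h, htu => htu.symm.trans h
  | .unit, _, _, _, _, _ => trivial
  | .prod _ _, _, _, _, h, htu => ⟨h.1.conv htu.fst, h.2.conv htu.snd⟩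
  | .arr _ _, _, _, _, h, htu => fun v a ha =>
    (h v a ha).imp fun _ h => ⟨h.1, h.2.conv (htu.app (.refl v))⟩

/-- The number `e` codes a sequence of codes of the values of the closed substitution `s`. -/
def ComputesSub : (Δ : Ctx) → Sub Δ [] → ℕ → Prop
  | [], _, _ => True
  | τ :: Δ, s, e =>
    ComputesSub Δ (fun _ x => s _ x.s) e.unpair.1 ∧ Computes τ (s _ .z) e.unpair.2

theorem Var.exists_lookup {Δ : Ctx} {σ : Ty} (x : Var Δ σ) : ∃ g : ℕ → ℕ, Computable g ∧
    ∀ s e, ComputesSub Δ s e → Computes σ (s _ x) (g e) := by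
  induction x with
  | z => exact ⟨_, Computable.snd.comp Computable.unpair, fun s e h => h.2⟩
  | s x ih =>
    obtain ⟨g, hg, h⟩ := ih
    exact ⟨_, hg.comp (Computable.fst.comp Computable.unpair), fun s e hs => h _ _ hs.1⟩

theorem eval_partrec {α : Type*} [Primcodable α] {f g : α → ℕ} (hf : Computable f)
    (hg : Computable g) : Partrec fun a => (Denumerable.ofNat Code (f a)).eval (g a) :=
  Code.eval_part.comp ((Computable.ofNat Code).comp hf) hg

/-- Every term is computed by a partial recursive function of its free variables. -/
theorem Tm.exists_partrec {Δ : Ctx} {σ : Ty} (t : Tm Δ σ) : ∃ F : ℕ →. ℕ, Partrec F ∧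
    ∀ s e, ComputesSub Δ s e → ∃ b ∈ F e, Computes σ (t.subst s) b := by
  induction t with
  | var x =>
    obtain ⟨g, hg, h⟩ := x.exists_lookup
    exact ⟨_, hg.partrec, fun s e hs => ⟨_, Part.mem_some _, h s e hs⟩⟩
  | lam t ih =>
    obtain ⟨F, hF, h⟩ := ih
    obtain ⟨c, rfl⟩ := Code.exists_code.1 (Partrec.nat_iff.1 hF)
    -- By the s-m-n theorem, fixing the environment `e` in a code for the body gives an index of the
    -- abstraction.
    refine ⟨fun e => Part.some (Encodable.encode (c.curry e)),
      (Computable.encode.comp (Code.primrec₂_curry.to_comp.comp (Computable.const c)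
        Computable.id)).partrec, fun s e hs => ⟨_, Part.mem_some _, fun u a ha => ?_⟩⟩
    rw [Denumerable.ofNat_encode, Code.eval_curry]
    obtain ⟨b, hb, hbt⟩ := h (Sub.cons u s) (Nat.pair e a) (by simpa [ComputesSub] using ⟨hs, ha⟩)
    refine ⟨b, hb, hbt.conv (.symm ((Conv.beta _ _).trans (.of_eq ?_)))⟩
    rw [Tm.inst, Tm.subst_subst, Sub.lift_comp_cons, Sub.comp_id]
  | app t u iht ihu =>
    obtain ⟨F, hF, h⟩ := iht
    obtain ⟨G, hG, h'⟩ := ihu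
    refine ⟨fun e => (F e).bind fun c => (G e).bind fun a => (Denumerable.ofNat Code c).eval a,
      hF.bind ((hG.comp Computable.fst).bind
        (eval_partrec (Computable.snd.comp Computable.fst) Computable.snd)), fun s e hs => ?_⟩
    obtain ⟨c, hc, hct⟩ := h s e hs
    obtain ⟨a, ha, hau⟩ := h' s e hs
    obtain ⟨b, hb, hbt⟩ := hct _ a hau
    exact ⟨b, Part.mem_bind hc (Part.mem_bind ha hb), hbt⟩
  | pair t u iht ihu =>
    obtain ⟨F, hF, h⟩ := iht
    obtain ⟨G, hG, h'⟩ := ihu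
    refine ⟨fun e => (F e).bind fun c => (G e).map fun a => Nat.pair c a,
      hF.bind ((hG.comp Computable.fst).map
        (Primrec₂.natPair.to_comp.comp (Computable.snd.comp Computable.fst) Computable.snd)),
      fun s e hs => ?_⟩
    obtain ⟨c, hc, hct⟩ := h s e hs
    obtain ⟨a, ha, hau⟩ := h' s e hs
    refine ⟨_, Part.mem_bind hc (Part.mem_map _ ha), ?_⟩
    simp only [Computes, Nat.unpair_pair]
    exact ⟨hct.conv (.symm (.fst_pair _ _)), hau.conv (.symm (.snd_pair _ _))⟩
  | fst t ih =>
    obtain ⟨F, hF, h⟩ := ih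
    refine ⟨_, hF.map (Computable.fst.comp (Computable.unpair.comp Computable.snd)).to₂,
      fun s e hs => ?_⟩
    obtain ⟨c, hc, hct⟩ := h s e hs
    exact ⟨_, Part.mem_map _ hc, hct.1⟩
  | snd t ih =>
    obtain ⟨F, hF, h⟩ := ih
    refine ⟨_, hF.map (Computable.snd.comp (Computable.unpair.comp Computable.snd)).to₂,
      fun s e hs => ?_⟩
    obtain ⟨c, hc, hct⟩ := h s e hs
    exact ⟨_, Part.mem_map _ hc, hct.2⟩
  | star => exact ⟨_, (Computable.const 0).partrec, fun s e _ => ⟨_, Part.mem_some _, trivial⟩⟩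
  | zero => exact ⟨_, (Computable.const 0).partrec, fun s e _ => ⟨_, Part.mem_some _, .refl _⟩⟩
  | succ t ih =>
    obtain ⟨F, hF, h⟩ := ih
    refine ⟨_, hF.map (Computable.succ.comp Computable.snd).to₂, fun s e hs => ?_⟩
    obtain ⟨c, hc, hct⟩ := h s e hs
    exact ⟨_, Part.mem_map _ hc, Conv.succ hct⟩
  | @natRec _ σ a f n iha ihf ihn =>
    obtain ⟨A, hA, ha⟩ := iha
    obtain ⟨F, hF, hf⟩ := ihf
    obtain ⟨N, hN, hn⟩ := ihn
    let step (c k v : ℕ) : Part ℕ := ((Denumerable.ofNat Code c).eval k).bind fun d =>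
      (Denumerable.ofNat Code d).eval v
    -- For arbitrary indices the iteration may diverge; `key` below proves, by induction on the
    -- numeral, that it halts on the codes that arise.
    let iter (c x k : ℕ) : Part ℕ := k.rec (Part.some x) fun k ih => ih.bind (step c k)
    refine ⟨fun e => (N e).bind fun k => (F e).bind fun c => (A e).bind fun x => iter c x k,
      hN.bind ((hF.comp Computable.fst).bind ((hA.comp (Computable.fst.comp Computable.fst)).bind
        ?_)), fun s e hs => ?_⟩
    · refine Partrec.nat_rec (f := fun p : ((ℕ × ℕ) × ℕ) × ℕ => p.1.1.2)
        (g := fun p => Part.some p.2) (h := fun p q => step p.1.2 q.1 q.2)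
        (Computable.snd.comp (Computable.fst.comp Computable.fst)) Computable.snd.partrec ?_
      refine Partrec.bind (eval_partrec
          (Computable.snd.comp (Computable.fst.comp Computable.fst))
          (Computable.fst.comp Computable.snd)) ?_
      exact eval_partrec Computable.snd
          (Computable.snd.comp (Computable.snd.comp Computable.fst))
    · obtain ⟨k, hk, hkn⟩ := hn s e hs
      obtain ⟨c, hc, hcf⟩ := hf s e hs
      obtain ⟨x, hx, hxa⟩ := ha s e hs
      have key : ∀ k, ∃ b ∈ iter c x k,
          Computes σ (.natRec (a.subst s) (f.subst s) (num k)) b := by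
        intro k
        induction k with
        | zero => exact ⟨x, Part.mem_some _, hxa.conv (.symm (.natRec_zero _ _))⟩
        | succ k ih =>
          obtain ⟨v, hv, hvk⟩ := ih
          obtain ⟨d, hd, hdf⟩ := hcf (num k) k (.refl _)
          obtain ⟨b, hb, hbf⟩ := hdf _ v hvk
          exact ⟨b, Part.mem_bind hv (Part.mem_bind hd hb),
            hbf.conv (.symm (.natRec_succ _ _ _))⟩
      obtain ⟨b, hb, hbk⟩ := key k
      exact ⟨b, Part.mem_bind hk (Part.mem_bind hc (Part.mem_bind hx hb)),
        hbk.conv (.natRec (.refl _) (.refl _) (.symm hkn))⟩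

/-- Every term of type `0` in one variable of type `0` defines a recursive function. -/
theorem Tm.exists_computable (t : Tm [Ty.nat] Ty.nat) : ∃ f : ℕ → ℕ, Computable f ∧
    ∀ n, Conv (t.inst (num n)) (num (f n)) := by
  obtain ⟨F, hF, h⟩ := t.exists_partrec
  choose f hf hft using fun n : ℕ =>
    -- Any number codes the empty substitution, here `0`.
    h (Sub.cons (num n) (Sub.id [])) (Nat.pair 0 n)
      (by simp [ComputesSub, Computes, Sub.cons, Conv.refl])
  refine ⟨f, ?_, hft⟩
  -- The chosen value is the unique value of `F` at `Nat.pair 0 n`, so the choice is computable.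
  refine (hF.comp (Primrec₂.natPair.to_comp.comp (Computable.const 0) Computable.id)).of_eq
    fun n => Part.eq_some_iff.2 (hf n)

/-- Every closed term of type `0` converts to a numeral. -/
theorem Tm.exists_conv_num (t : Tm [] Ty.nat) : ∃ n, Conv t (num n) := by
  -- The closed term is viewed as depending on a dummy variable, instantiated by `0`.
  obtain ⟨f, -, hf⟩ := (t.wk : Tm [Ty.nat] Ty.nat).exists_computable
  exact ⟨f 0, by simpa using hf 0⟩

/-! ### Explicit definability for closed formulas -/

theorem Prf.inst_conv {Δ : Ctx} {L : List (Fm Δ)} {τ : Ty} {A : Fm (τ :: Δ)} {t u : Tm Δ τ}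
    (h : Prf R L (A.inst t)) (htu : Conv t u) : Prf R L (A.inst u) :=
  (A.subst_equiv (.cons (.refl _) htu) L).1 h

/-- Without assumptions there are no realizer variables, so the witness term is closed. -/
theorem Prf.exists_num {A : Fm [Ty.nat]} (h : Prf R [] (.ex Ty.nat A)) :
    ∃ n : ℕ, Prf R [] (A.inst (num n)) := by
  obtain ⟨t, ht⟩ := h.existence
  obtain ⟨n, hn⟩ := Tm.exists_conv_num t
  exact ⟨n, Prf.inst_conv ht hn⟩

/-- The selecting number in the realizer is a closed term; whether its numeral is zero or a
successor decides the side. -/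
theorem Prf.disjunction {A B : Fm []} (h : Prf R [] (.or A B)) : Prf R [] A ∨ Prf R [] B := by
  obtain ⟨t, ht⟩ := h.realizable (s := Sub.id []) (L' := []) (by simp)
  obtain ⟨n, hn⟩ := Tm.exists_conv_num (.snd t)
  cases n with
  | zero =>
    have := Prf.truth_of_mrt (.impE ht.andE₁ (.eqConv hn))
    exact .inl (by rwa [Fm.subst_id] at this)
  | succ n =>
    have := Prf.truth_of_mrt (.impE ht.andE₂
      (.impI (.impE .succ_ne_zero (.eq_trans (.eq_symm (.eqConv hn)) .hyp))))
    exact .inr (by rwa [Fm.subst_id] at this)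

theorem Prf.exists_computable_choice {A : Fm [Ty.nat, Ty.nat]}
    (h : Prf R [] (.all Ty.nat (.ex Ty.nat A))) : ∃ f : ℕ → ℕ, Computable f ∧
      ∀ n : ℕ, Prf R [] ((A.inst (num (f n))).inst (num n)) := by
  -- Opening the universal quantifier leaves one free variable, so the witness is a term in that
  -- variable alone.
  obtain ⟨t, ht⟩ : ∃ t : Tm [Ty.nat] Ty.nat, Prf R [] (A.inst t) := h.all_open.existence
  obtain ⟨f, hf, hft⟩ := t.exists_computable
  refine ⟨f, hf, fun n => ?_⟩
  have := ht.subst (Sub.cons (num n) (Sub.id []))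
  rw [List.map_nil, Fm.inst_subst] at this
  have := this.inst_conv (hft n)
  rw [Fm.inst, Fm.inst_subst, num_subst]
  exact this

end HAOmega

theorem mainTheorem3 (R : Set Ty) (hR : R = Set.univ ∨ R = {Ty.nat}) :
    -- Existence Property
    (∀ (Δ : Ctx) (Γ : List (Fm Δ)) (τ : Ty) (A : Fm (τ :: Δ)),
      Prf R Γ (.ex τ A) →
        ∃ t : Tm (realCtx Γ) τ, Prf R (mrtCtx Γ) (A.subst (Sub.cons t (realWk Γ)))) ∧
    -- Existence Property for closed arithmetical formulas
    (∀ A : Fm [Ty.nat], A.Arithmetical → Prf R [] (.ex Ty.nat A) →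
      ∃ n : ℕ, Prf R [] (A.inst (num n))) ∧
    -- Disjunction Property for closed arithmetical formulas
    (∀ A B : Fm [], A.Arithmetical → B.Arithmetical → Prf R [] (.or A B) →
      Prf R [] A ∨ Prf R [] B) ∧
    -- Weak Church Rule for closed arithmetical formulas
    (∀ A : Fm [Ty.nat, Ty.nat], A.Arithmetical →
      Prf R [] (.all Ty.nat (.ex Ty.nat A)) →
        ∃ f : ℕ → ℕ, Computable f ∧
          ∀ n : ℕ, Prf R [] ((A.inst (num (f n))).inst (num n))) :=
  ⟨fun _ _ _ _ h => h.existence, fun _ _ h => h.exists_num, fun _ _ _ _ h => h.disjunction,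
    fun _ _ h => h.exists_computable_choice⟩
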